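/- **Setting.** Let $\mathcal Q$ be a finite set. Consider the stochastic hybrid system on $\mathcal Q\times[0,\infty)$ with vector fields $f(q,\cdot)$, jump rates $\lambda_{q'}(q,\cdot)$ and resets $\psi_{q'}(q,x)=\gamma_{qq'}x$ ($q,q'\in\mathcal Q$), where $f(q,\cdot)$ and $\lambda_{q'}(q,\cdot)$ are real polynomials, $f(q,0)\ge 0$, $\lambda_{q'}(q,x)\ge 0$ for $x\ge 0$, and $\gamma_{qq'}\ge 0$. Its process $(Q_t,X_t)$ is defined as follows. Between jumps $Q_t$ is constant and $\dot X_t=f(Q_t,X_t)$. After the $n$-th jump time $T_n$ ($T_0=0$), the transition to $q'$ would fire at the first time at which $\int_{T_n}^{t}\lambda_{q'}(Q_{T_n},X_s)\,ds$, computed along the trajectory of $f(Q_{T_n},\cdot)$ that starts at $X_{T_n}$, reaches $S_{n+1}^{(q')}$. Here the $S_n^{(q)}$ are i.i.d. exponential variables with parameter $1$, independent of $(Q_0,X_0)$. The transition that fires first takes place, at time $T_{n+1}$: $Q$ becomes its target $q'$ and $X$ is multiplied by $\gamma_{qq'}$, where $q=Q_{T_n}$. After an explosion (accumulation of the jump times,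 or blow-up of the trajectory) $X_t=\infty$. Let $\deg(F)=\max_q\deg f(q,\cdot)$ and $\deg(\Lambda)=\max_{k,l}\deg\lambda_l(k,\cdot)$, where the zero polynomial counts as degree $0$. Let $\beta_{kl}$ be the coefficient of $x^{\deg(\Lambda)}$ in $\lambda_l(k,x)$. For $m\ge 1$ the top matrix of degree $m$ is $$M^{(m)}_{kl}=\gamma_{lk}^m\beta_{lk}\quad(k\ne l),\qquad M^{(m)}_{kk}=\gamma_{kk}^m\beta_{kk}-\sum_{l\in\mathcal Q}\beta_{kl}$$ (the term $\gamma_{kk}^m\beta_{kk}$ is absent when there are no jumps from a discrete state to itself). Write $\mu_\theta^{(m)}=\mathbb E[1_{Q=\theta}X^m]$ and $\mu^{(m)}=\sum_\theta\mu_\theta^{(m)}=\mathbb E[X^m]$. With $f(\theta,x)=\sum_a\alpha_{a,\theta}x^a$ and $\lambda_l(k,x)=\sum_b\beta_{b,kl}x^b$, the moment flow equations are, for $m\ge 1$ and $\theta\in\mathcal Q$, $$\frac{d}{dt}\mu_\theta^{(m)}=m\sum_a\alpha_{a,\theta}\,\mu_\theta^{(a+m-1)}+\sum_{k}\sum_b\gamma_{k\theta}^m\beta_{b,k\theta}\,\mu_k^{(b+m)}-\sum_k\sum_b\beta_{b,\theta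 k}\,\mu_\theta^{(b+m)} .$$ An orbit of the moment flow equations is a solution on $[0,\infty)$ that consists, at every time $t\ge0$, of the moments of a probability law on $\mathcal Q\times[0,\infty)$ with finite moments of all orders. **Theorem.** Assume $\deg(F)\le\deg(\Lambda)$. Let $m\ge1$, and suppose that all eigenvalues of $M^{(m)}$ are negative (have negative real part, if complex). Then 1. along every orbit of the moment flow equations, the total $m$-th moment $\mu^{(m)}(t)$ is bounded on $[0,\infty)$; 2. for every initial state $(Q_0,X_0)$ with $\mathbb E[X_0^m]<\infty$, the total $m$-th moment of the process satisfies $\sup_{t\ge0}\mathbb E[X_t^m]<\infty$. In particular, if $M^{(m)}$ has negative spectrum for all $m\ge1$, then for every $m\ge 1$ the total $m$-th moment is bounded along every orbit of the moment flow equations, and $\sup_{t\ge0}\mathbb E[X_t^m]<\infty$ for every $m\ge1$ whenever $X_0$ has finite moments of all orders. -/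

import Mathlib

open scoped NNReal ENNReal Polynomial
open MeasureTheory ProbabilityTheory

/-- A stochastic hybrid system with finitely many discrete states, continuous state space
`ℝ⁺ = [0, ∞)`, polynomial vector fields, polynomial jump rates and linear resets.

* `f q` is the vector field in the discrete state `q`; it must not point out of `[0, ∞)` at `0`;
* `rate q q'` is `x ↦ λ_{q'}(q, x)`, the rate of jumping from `(q, x)` to the discrete state `q'`;
* the reset map of the transition `q ↦ q'` is `x ↦ γ q q' * x`. -/
structure SHS (Q : Type*) where
  f : Q → ℝ[X]
  rate : Q → Q → ℝ[X]
  γ : Q → Q → ℝ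
  f_zero_nonneg : ∀ q, 0 ≤ (f q).eval 0
  rate_nonneg : ∀ q q' x, 0 ≤ x → 0 ≤ (rate q q').eval x
  γ_nonneg : ∀ q q', 0 ≤ γ q q'

noncomputable section

/-! ### The flow of a polynomial vector field -/

/-- `y` solves `y' = p(y)`, `y(0) = x` on the time interval `[0, t]`. -/
def IsSolutionOn (p : ℝ[X]) (x t : ℝ) (y : ℝ → ℝ) : Prop :=
  y 0 = x ∧ ∀ s ∈ Set.Icc 0 t, HasDerivWithinAt y (p.eval (y s)) (Set.Icc 0 t) s

/-- The trajectory of `x` under `y' = p(y)` exists on the whole of `[0, t]`. -/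
def Survives (p : ℝ[X]) (x t : ℝ) : Prop := ∃ y, IsSolutionOn p x t y

open Classical in
/-- The flow map `φ^t(x)` of `y' = p(y)`; the value `0` is a dummy used only if the
trajectory does not exist up to time `t`. Solutions are unique, hence the choice is harmless. -/
def flow (p : ℝ[X]) (x t : ℝ) : ℝ :=
  if h : Survives p x t then h.choose t else 0

namespace SHS

variable {Q : Type*}

/-! ### The stochastic process -/

/-- The waiting time `T^{(q')}` until the transition to `q'` would fire, when the process is
now in the state `(q, x)` and the exponential clock of that transition is `s`: the first time `t`
at which `∫₀ᵗ λ_{q'}(q, φ^u(q, x)) du` reaches `s`; it is `∞` if that never happens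
during the life of the trajectory. -/
def fireTime (H : SHS Q) (q : Q) (x : ℝ) (q' : Q) (s : ℝ) : ℝ≥0∞ :=
  ⨅ (t : ℝ≥0) (_ : Survives (H.f q) x t ∧
      s ≤ ∫ u in (0 : ℝ)..t, (H.rate q q').eval (flow (H.f q) x u)), (t : ℝ≥0∞)

/-- The waiting time until the next jump. -/
def waitTime (H : SHS Q) (q : Q) (x : ℝ) (s : Q → ℝ) : ℝ≥0∞ :=
  ⨅ q', H.fireTime q x q' (s q')

/-- The discrete state after the next jump: the transition that fires first. -/
def target [Fintype Q] (H : SHS Q) (q : Q) (x : ℝ) (s : Q → ℝ) : Q :=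
  haveI : Nonempty Q := ⟨q⟩
  (Finite.exists_min fun q' => H.fireTime q x q' (s q')).choose

/-- `jumpChain H s q x n = (Tₙ, Q_{Tₙ}, X_{Tₙ})`, where `Tₙ` is the time of the `n`-th jump of the
process that starts in `(q, x)` and uses the clocks `s n` for its jump number `n + 1`.
If there are fewer than `n` jumps then `Tₙ = ∞`, and the other two entries mean nothing. -/
def jumpChain [Fintype Q] (H : SHS Q) (s : ℕ → Q → ℝ) (q : Q) (x : ℝ) : ℕ → ℝ≥0∞ × Q × ℝ
  | 0 => (0, q, x)
  | n + 1 =>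
    let a := jumpChain H s q x n
    let w := H.waitTime a.2.1 a.2.2 (s n)
    let q' := H.target a.2.1 a.2.2 (s n)
    (a.1 + w, q', H.γ a.2.1 q' * flow (H.f a.2.1) a.2.2 w.toReal)

/-- At time `t` the process has made exactly `n` jumps, and the trajectory followed since the
`n`-th jump has not blown up. -/
def IsActive [Fintype Q] (H : SHS Q) (s : ℕ → Q → ℝ) (q : Q) (x : ℝ) (t : ℝ≥0) (n : ℕ) : Prop :=
  (H.jumpChain s q x n).1 ≤ t ∧ t < (H.jumpChain s q x (n + 1)).1 ∧
    Survives (H.f (H.jumpChain s q x n).2.1) (H.jumpChain s q x n).2.2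
      (t - (H.jumpChain s q x n).1.toReal)

open Classical in
/-- The state `(Q_t, X_t)` at time `t` of the process that starts in `(q, x)` and is driven by the
clocks `s`; it is `none` if the process has exploded, either because the jump times have
accumulated or because the continuous trajectory has blown up. At most one `n` is active, hence
the choice is harmless. -/
def state [Fintype Q] (H : SHS Q) (s : ℕ → Q → ℝ) (q : Q) (x : ℝ) (t : ℝ≥0) : Option (Q × ℝ) :=
  if h : ∃ n, H.IsActive s q x t n then
    let a := H.jumpChain s q x h.choose
    some (a.2.1, flow (H.f a.2.1) a.2.2 (t - a.1.toReal))
  else none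

/-- The continuous state `X_t ∈ [0, ∞]`; it is `∞` after an explosion. -/
def contState [Fintype Q] (H : SHS Q) (s : ℕ → Q → ℝ) (q : Q) (x : ℝ) (t : ℝ≥0) : ℝ≥0∞ :=
  match H.state s q x t with
  | some y => ENNReal.ofReal y.2
  | none => ⊤

/-- The randomness of the process: the clocks `S n q` are i.i.d. exponential random variables
with parameter `1`, independent of the initial state `(Q₀, X₀)`, and `X₀ ≥ 0`. -/
structure IsInput [MeasurableSpace Q] {Ω : Type*} [MeasurableSpace Ω] (P : Measure Ω)
    (S : ℕ → Q → Ω → ℝ) (Q₀ : Ω → Q) (X₀ : Ω → ℝ) : Prop where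
  measurable_clock : ∀ n q, Measurable (S n q)
  clock_law : ∀ n q, P.map (S n q) = expMeasure 1
  clock_indep : iIndepFun (fun i : ℕ × Q => S i.1 i.2) P
  measurable_discrete : Measurable Q₀
  measurable_cont : Measurable X₀
  cont_nonneg : ∀ᵐ ω ∂P, 0 ≤ X₀ ω
  indep_init : IndepFun (fun ω => (Q₀ ω, X₀ ω)) (fun ω (i : ℕ × Q) => S i.1 i.2 ω) P

/-- The total `m`-th moment `E[X_t^m] ∈ [0, ∞]` of the process. -/
def processMoment [Fintype Q] (H : SHS Q) {Ω : Type*} [MeasurableSpace Ω] (P : Measure Ω)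
    (S : ℕ → Q → Ω → ℝ) (Q₀ : Ω → Q) (X₀ : Ω → ℝ) (m : ℕ) (t : ℝ≥0) : ℝ≥0∞ :=
  ∫⁻ ω, H.contState (fun n q => S n q ω) (Q₀ ω) (X₀ ω) t ^ m ∂P

/-! ### Moments and the moment flow equations -/

open Classical in
/-- The moment `μ_θ^{(m)} = E[1_θ(Q) X^m]` of a law of `(Q, X)`. -/
def moment [MeasurableSpace Q] (ρ : Measure (Q × ℝ)) (m : ℕ) (θ : Q) : ℝ :=
  ∫ y, (if y.1 = θ then y.2 ^ m else 0) ∂ρ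

/-- The total `m`-th moment `μ^{(m)} = ∑_θ μ_θ^{(m)}` of a law of `(Q, X)`. -/
def totalMoment [Fintype Q] [MeasurableSpace Q] (ρ : Measure (Q × ℝ)) (m : ℕ) : ℝ :=
  ∑ θ, moment ρ m θ

/-- The right-hand side of the moment flow equation for `μ_θ^{(m)}`, `m ≥ 1`. -/
def momentField [Fintype Q] (H : SHS Q) (μ : ℕ → Q → ℝ) (m : ℕ) (θ : Q) : ℝ :=
  m * ((H.f θ).sum fun a α => α * μ (a + m - 1) θ)
    + ∑ k, ((H.rate k θ).sum fun b β => H.γ k θ ^ m * β * μ (b + m) k)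
    - ∑ k, ((H.rate θ k).sum fun b β => β * μ (b + m) θ)

/-- An orbit of the moment flow equations: probability laws `ρ t`, `t ≥ 0`, on `Q × ℝ⁺` that have
finite moments of all orders, and whose moments solve the moment flow equations. -/
structure IsMomentOrbit [Fintype Q] [MeasurableSpace Q] (H : SHS Q)
    (ρ : ℝ → Measure (Q × ℝ)) : Prop where
  isProbabilityMeasure : ∀ t, 0 ≤ t → IsProbabilityMeasure (ρ t)
  nonneg : ∀ t, 0 ≤ t → ∀ᵐ y ∂ρ t, 0 ≤ y.2
  integrable : ∀ t, 0 ≤ t → ∀ m : ℕ, Integrable (fun y => y.2 ^ m) (ρ t)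
  flow_eq : ∀ t, 0 ≤ t → ∀ m : ℕ, 1 ≤ m → ∀ θ,
    HasDerivWithinAt (fun s => moment (ρ s) m θ) (H.momentField (moment (ρ t)) m θ)
      (Set.Ici 0) t

/-! ### Degrees and the top matrix -/

/-- `deg F`, the largest degree of a vector field. -/
def degF [Fintype Q] (H : SHS Q) : ℕ :=
  Finset.univ.sup fun q => (H.f q).natDegree

/-- `deg Λ`, the largest degree of a jump rate. -/
def degRate [Fintype Q] (H : SHS Q) : ℕ :=
  Finset.univ.sup fun k => Finset.univ.sup fun l => (H.rate k l).natDegree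

/-- `β_{kl}`, the coefficient of degree `deg Λ` of `λ_l(k, x)`. -/
def topCoeff [Fintype Q] (H : SHS Q) (k l : Q) : ℝ :=
  (H.rate k l).coeff H.degRate

/-- The top matrix of degree `m`, that is, the matrix of the terms of order `m + deg Λ` in the
moment flow equations. -/
def topMatrix [Fintype Q] [DecidableEq Q] (H : SHS Q) (m : ℕ) : Matrix Q Q ℝ :=
  Matrix.of fun k l =>
    H.γ l k ^ m * H.topCoeff l k - if k = l then ∑ j, H.topCoeff k j else 0

/-- Without jumps from a discrete state to itself, the top matrix has the off-diagonal entries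
`γ_{lk}^m β_{lk}` and the diagonal entries `-∑_l β_{kl}`. -/
theorem topMatrix_apply_of_no_self_jump [Fintype Q] [DecidableEq Q] (H : SHS Q)
    (h : ∀ q, H.rate q q = 0) (m : ℕ) (k l : Q) :
    H.topMatrix m k l =
      if k = l then -∑ j, H.topCoeff k j else H.γ l k ^ m * H.topCoeff l k := by
  by_cases hkl : k = l
  · subst hkl
    simp [topMatrix, topCoeff, h]
  · simp [topMatrix, hkl]

/-- All complex eigenvalues of a real matrix have negative real part. -/
def NegativeSpectrum [Fintype Q] [DecidableEq Q] (M : Matrix Q Q ℝ) : Prop :=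
  ∀ z ∈ spectrum ℂ (M.map (algebraMap ℝ ℂ)), z.re < 0

end SHS

end

/-! In each discrete state `q` the generator maps `V = v q * x ^ m` to a polynomial in `x`. As `deg
F ≤ deg Λ`, the vector field contributes only degrees up to `m - 1 + deg Λ`. The coefficient of
degree `m + deg Λ` therefore comes from the jumps alone, and it is the `q`-th entry of the row
vector `v M`, where `M` is the top matrix. Rates that are nonnegative on `[0, ∞)` have nonnegative
top coefficients, so `M` is nonnegative off the diagonal. A Perron–Frobenius argument
(`Matrix.exists_pos_mulVec_neg`, applied to the transpose) then yields `v > 0` with all entries of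
`v M` negative. A polynomial with negative top coefficient is bounded above, which gives the
Foster–Lyapunov inequality `L V ≤ ε (K - V) - Λ` with the total jump rate `Λ` (`SHS.exists_drift`).

Along a moment orbit the derivative of `E[V]` is `E[L V]`, and a Gronwall argument bounds `E[V]`.

For the process, neither non-explosion nor finiteness of moments is known beforehand, so the
inequality is not integrated in time directly. It is integrated up to the first jump
(`SHS.drift_integral_le`): the bound `exp (-ε t) V + K (1 - exp (-ε t))` dominates the contribution
of no jump up to `t` plus the expected bound after the first jump. The spare term `-Λ` allows a
reward `exp (-ε t)` for that jump. A trajectory that blows up is covered by Fatou's lemma, with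
contribution `∞` (`SHS.lintegral_step_le`). The clocks of the next jump are independent of the past,
so the one-step inequalities telescope. The active contributions then have an expected sum bounded
uniformly in `t`, and the rewards show that almost surely only finitely many jumps happen up to `t`.
-/

/-! ### Perron–Frobenius and the drift condition -/

open Filter Topology Matrix in
/-- A Metzler matrix without eigenvalues in `[0, ∞)` maps a positive vector to a negative one. -/
theorem Matrix.exists_pos_mulVec_neg {Q : Type*} [Fintype Q] [DecidableEq Q] (N : Matrix Q Q ℝ)
    (hoff : ∀ i j, i ≠ j → 0 ≤ N i j)
    (hdet : ∀ s : ℝ, 0 ≤ s → (s • (1 : Matrix Q Q ℝ) - N).det ≠ 0) :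
    ∃ v : Q → ℝ, (∀ i, 0 < v i) ∧ ∀ i, (N *ᵥ v) i < 0 := by
  -- A homotopy from `1` to `-N` through invertible matrices; for `τ > 0` invertibility is `hdet` at
  -- `s = (1 - τ) / τ`. The solution of `B τ w = 1` stays positive along the way.
  set B : ℝ → Matrix Q Q ℝ := fun τ => (1 - τ) • (1 : Matrix Q Q ℝ) - τ • N with hB
  have hBdet : ∀ τ ∈ Set.Icc (0 : ℝ) 1, (B τ).det ≠ 0 := by
    intro τ hτ
    rcases hτ.1.eq_or_lt with h0 | h0
    · simp [hB, ← h0]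
    · have : B τ = τ • (((1 - τ) / τ) • (1 : Matrix Q Q ℝ) - N) := by
        simp only [hB, smul_sub, smul_smul]
        rw [mul_div_cancel₀ _ h0.ne']
      rw [this, Matrix.det_smul]
      exact mul_ne_zero (pow_ne_zero _ h0.ne')
        (hdet _ (div_nonneg (by linarith [hτ.2]) h0.le))
  have hBc : Continuous B := by
    simp only [hB]; fun_prop
  set w : ℝ → Q → ℝ := fun τ => (B τ)⁻¹ *ᵥ 1 with hw
  have hBw : ∀ τ ∈ Set.Icc (0 : ℝ) 1, B τ *ᵥ w τ = 1 := by
    intro τ hτ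
    simp only [hw, Matrix.mulVec_mulVec]
    rw [Matrix.mul_nonsing_inv _ (isUnit_iff_ne_zero.2 (hBdet τ hτ)), Matrix.one_mulVec]
  have hwc : ∀ i, ContinuousOn (fun τ => w τ i) (Set.Icc 0 1) := by
    intro i
    have h1 : (fun τ => w τ i) = fun τ => ((B τ).det)⁻¹ * ((B τ).adjugate *ᵥ 1) i := by
      funext τ
      simp [hw, Matrix.inv_def, Matrix.smul_mulVec]
    rw [h1]
    refine ContinuousOn.mul (ContinuousOn.inv₀ hBc.matrix_det.continuousOn hBdet) ?_
    exact ((continuous_apply i).comp (hBc.matrix_adjugate.matrix_mulVec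
      continuous_const)).continuousOn
  -- If `w τ i` vanished, row `i` of `B τ w = 1` would have only off-diagonal terms, all
  -- nonpositive.
  have hpos : ∀ τ ∈ Set.Icc (0 : ℝ) 1, (∀ i, 0 ≤ w τ i) → ∀ i, 0 < w τ i := by
    intro τ hτ h i
    refine lt_of_le_of_ne (h i) fun h0 => ?_
    have h1 := congrFun (hBw τ hτ) i
    rw [Matrix.mulVec, dotProduct, Pi.one_apply] at h1
    have h2 : ∑ j, B τ i j * w τ j ≤ 0 := by
      refine Finset.sum_nonpos fun j _ => ?_
      by_cases hij : i = j
      · subst hij; simp [← h0]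
      · simp only [hB, Matrix.sub_apply, Matrix.smul_apply, Matrix.one_apply_ne hij, smul_eq_mul,
          mul_zero, zero_sub, neg_mul, Left.neg_nonpos_iff]
        exact mul_nonneg (mul_nonneg hτ.1 (hoff i j hij)) (h j)
    linarith
  -- Continuous induction: the set is closed in `[0, 1]`, contains `0`, and is open to the right
  -- because `hpos` upgrades `≥` to `>`.
  have hsub : Set.Icc (0 : ℝ) 1 ⊆ {τ | ∀ i, 0 ≤ w τ i} := by
    refine IsClosed.Icc_subset_of_forall_mem_nhdsWithin ?_ ?_ ?_
    · have : {τ | ∀ i, 0 ≤ w τ i} ∩ Set.Icc 0 1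
          = Set.Icc 0 1 ∩ ⋂ i, (Set.Icc 0 1 ∩ (fun τ => w τ i) ⁻¹' Set.Ici 0) := by
        ext τ
        simp only [Set.mem_inter_iff, Set.mem_ofPred_eq, Set.mem_iInter, Set.mem_preimage,
          Set.mem_Ici]
        exact ⟨fun h => ⟨h.2, fun i => ⟨h.2, h.1 i⟩⟩, fun h => ⟨fun i => (h.2 i).2, h.1⟩⟩
      rw [this]
      exact isClosed_Icc.inter (isClosed_iInter fun i =>
        (hwc i).preimage_isClosed_of_isClosed isClosed_Icc isClosed_Ici)
    · intro i
      simp [hw, hB]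
    · rintro τ ⟨h1, h2⟩
      have h3 := hpos τ ⟨h2.1, h2.2.le⟩ h1
      have h4 : ∀ᶠ σ in 𝓝[>] τ, ∀ i, 0 < w σ i := by
        rw [eventually_all]
        intro i
        have h5 : Tendsto (fun σ => w σ i) (𝓝[>] τ) (𝓝 (w τ i)) :=
          ((hwc i).continuousWithinAt ⟨h2.1, h2.2.le⟩).tendsto.mono_left
            (nhdsWithin_le_iff.2 (mem_of_superset (Ioo_mem_nhdsGT h2.2)
              fun x hx => ⟨h2.1.trans hx.1.le, hx.2.le⟩))
        exact h5.eventually_const_lt (h3 i)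
      filter_upwards [h4] with σ hσ i using (hσ i).le
  have h1 : (1 : ℝ) ∈ Set.Icc (0 : ℝ) 1 := ⟨zero_le_one, le_rfl⟩
  refine ⟨w 1, hpos 1 h1 (hsub h1), fun i => ?_⟩
  have := congrFun (hBw 1 h1) i
  simp only [hB, sub_self, zero_smul, one_smul, zero_sub, Matrix.neg_mulVec, Pi.neg_apply,
    Pi.one_apply] at this
  linarith

/-- A polynomial whose coefficient of highest possible degree is negative is bounded above on
`[0, ∞)`. -/
theorem Polynomial.exists_eval_le_of_coeff_neg {p : ℝ[X]} {n : ℕ} (hn : p.natDegree ≤ n)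
    (hneg : p.coeff n < 0) : ∃ C, ∀ x, 0 ≤ x → p.eval x ≤ C := by
  have hd : p.natDegree = n := le_antisymm hn (Polynomial.le_natDegree_of_ne_zero hneg.ne)
  have hl : p.leadingCoeff < 0 := by rwa [Polynomial.leadingCoeff, hd]
  have hev : ∃ R, ∀ x, R ≤ x → p.eval x ≤ p.coeff 0 + 1 := by
    by_cases h0 : n = 0
    · refine ⟨0, fun x _ => ?_⟩
      rw [Polynomial.eq_C_of_natDegree_eq_zero (hd.trans h0)]
      simp
    · have : Filter.Tendsto (fun x => p.eval x) Filter.atTop Filter.atBot :=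
        p.tendsto_atBot_of_leadingCoeff_nonpos
          (Polynomial.natDegree_pos_iff_degree_pos.1 (by omega)) hl.le
      exact Filter.eventually_atTop.1 (this.eventually_le_atBot _)
  obtain ⟨R, hR⟩ := hev
  obtain ⟨C, hC⟩ := (isCompact_Icc (a := (0 : ℝ)) (b := R)).bddAbove_image
    (p.continuous.continuousOn (s := Set.Icc 0 R))
  refine ⟨max C (p.coeff 0 + 1), fun x hx => ?_⟩
  rcases le_total x R with h | h
  · exact (hC ⟨x, ⟨hx, h⟩, rfl⟩).trans (le_max_left _ _)
  · exact (hR x h).trans (le_max_right _ _)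

/-- The coefficient of highest possible degree of a polynomial that is nonnegative on `[0, ∞)`
is nonnegative. -/
theorem Polynomial.coeff_nonneg_of_eval_nonneg {p : ℝ[X]} {n : ℕ} (hn : p.natDegree ≤ n)
    (hp : ∀ x, 0 ≤ x → 0 ≤ p.eval x) : 0 ≤ p.coeff n := by
  by_contra! hneg
  have hd : p.natDegree = n := le_antisymm hn (Polynomial.le_natDegree_of_ne_zero hneg.ne)
  have hl : p.leadingCoeff < 0 := by rwa [Polynomial.leadingCoeff, hd]
  by_cases h0 : n = 0
  · subst h0
    have := hp 0 le_rfl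
    rw [← Polynomial.coeff_zero_eq_eval_zero] at this
    linarith
  · have : Filter.Tendsto (fun x => p.eval x) Filter.atTop Filter.atBot :=
      p.tendsto_atBot_of_leadingCoeff_nonpos
        (Polynomial.natDegree_pos_iff_degree_pos.1 (by omega)) hl.le
    obtain ⟨x, h1, h2⟩ :=
      ((this.eventually_lt_atBot 0).and (Filter.eventually_ge_atTop 0)).exists
    linarith [hp x h2]

namespace SHS

variable {Q : Type*} [Fintype Q]

theorem natDegree_f_le (H : SHS Q) (q : Q) : (H.f q).natDegree ≤ H.degF :=
  Finset.le_sup (f := fun q => (H.f q).natDegree) (Finset.mem_univ q)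

theorem natDegree_rate_le (H : SHS Q) (k l : Q) : (H.rate k l).natDegree ≤ H.degRate :=
  (Finset.le_sup (f := fun l => (H.rate k l).natDegree) (Finset.mem_univ l)).trans
    (Finset.le_sup (f := fun k => Finset.univ.sup fun l => (H.rate k l).natDegree)
      (Finset.mem_univ k))

theorem topCoeff_nonneg (H : SHS Q) (k l : Q) : 0 ≤ H.topCoeff k l :=
  Polynomial.coeff_nonneg_of_eval_nonneg (H.natDegree_rate_le k l) (H.rate_nonneg k l)

/-- A stable top matrix of degree `m` has a positive left vector on which it is negative. -/
theorem NegativeSpectrum.exists_pos_vecMul_neg [DecidableEq Q] {H : SHS Q} {m : ℕ}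
    (h : NegativeSpectrum (H.topMatrix m)) :
    ∃ v : Q → ℝ, (∀ q, 0 < v q) ∧
      ∀ q, (∑ l, H.γ q l ^ m * H.topCoeff q l * v l) - v q * ∑ l, H.topCoeff q l < 0 := by
  have hoff : ∀ i j, i ≠ j → 0 ≤ (H.topMatrix m).transpose i j := by
    intro i j hij
    simp only [topMatrix, Matrix.transpose_apply, Matrix.of_apply, if_neg hij.symm, sub_zero]
    exact mul_nonneg (pow_nonneg (H.γ_nonneg _ _) _) (H.topCoeff_nonneg _ _)
  have hdet : ∀ s : ℝ, 0 ≤ s →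
      (s • (1 : Matrix Q Q ℝ) - (H.topMatrix m).transpose).det ≠ 0 := by
    intro s hs h0
    have h1 : (s • (1 : Matrix Q Q ℝ) - (H.topMatrix m).transpose)
        = (s • (1 : Matrix Q Q ℝ) - H.topMatrix m).transpose := by simp
    rw [h1, Matrix.det_transpose] at h0
    have h2 : (s : ℂ) ∈ spectrum ℂ ((H.topMatrix m).map (algebraMap ℝ ℂ)) := by
      rw [spectrum.mem_iff, Matrix.isUnit_iff_isUnit_det]
      have h3 : (algebraMap ℂ (Matrix Q Q ℂ) (s : ℂ) - (H.topMatrix m).map (algebraMap ℝ ℂ))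
          = (algebraMap ℝ ℂ).mapMatrix (s • (1 : Matrix Q Q ℝ) - H.topMatrix m) := by
        ext i j
        by_cases hij : i = j <;>
          simp [Matrix.algebraMap_matrix_apply, hij]
      rw [h3, ← RingHom.map_det, h0]
      simp
    have := h _ h2
    simp at this
    linarith
  obtain ⟨v, hv, hneg⟩ := Matrix.exists_pos_mulVec_neg _ hoff hdet
  refine ⟨v, hv, fun q => ?_⟩
  have := hneg q
  simp only [Matrix.mulVec, dotProduct, Matrix.transpose_apply, topMatrix, Matrix.of_apply,
    sub_mul, ite_mul, zero_mul, Finset.sum_sub_distrib, Finset.sum_ite_eq', Finset.mem_univ,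
    if_true] at this
  rwa [mul_comm (v q)]

/-- The generator of the process applied to the function `(q, x) ↦ v q * x ^ m`, as a polynomial
in `x`. -/
noncomputable def genPoly (H : SHS Q) (v : Q → ℝ) (m : ℕ) (q : Q) : ℝ[X] :=
  Polynomial.C (v q * m) * Polynomial.X ^ (m - 1) * H.f q
    + ∑ l, Polynomial.C (H.γ q l ^ m * v l - v q) * Polynomial.X ^ m * H.rate q l

theorem eval_genPoly (H : SHS Q) (v : Q → ℝ) (m : ℕ) (q : Q) (x : ℝ) :
    (H.genPoly v m q).eval x = v q * m * x ^ (m - 1) * (H.f q).eval x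
      + ∑ l, (H.γ q l ^ m * v l - v q) * x ^ m * (H.rate q l).eval x := by
  simp [genPoly, Polynomial.eval_finsetSum]

open Topology in
/-- The drift condition of Foster and Lyapunov for the function `(q, x) ↦ v q * x ^ m`. -/
theorem exists_drift [DecidableEq Q] {H : SHS Q} (hdeg : H.degF ≤ H.degRate) {m : ℕ} (hm : 1 ≤ m)
    (h : NegativeSpectrum (H.topMatrix m)) :
    ∃ (v : Q → ℝ) (ε K : ℝ), (∀ q, 0 < v q) ∧ 0 < ε ∧ 0 ≤ K ∧ ∀ q x, 0 ≤ x →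
      (H.genPoly v m q).eval x ≤ K * ε - ε * (v q * x ^ m) - ∑ l, (H.rate q l).eval x := by
  obtain ⟨v, hv, hneg⟩ := h.exists_pos_vecMul_neg
  set b : Q → ℝ := fun q =>
    (∑ l, H.γ q l ^ m * H.topCoeff q l * v l) - v q * ∑ l, H.topCoeff q l with hb
  -- For constant rates `x ^ m` is itself of top degree, so `ε * v q` must not spoil the sign of `b
  -- q`.
  obtain ⟨ε, hε, hε'⟩ : ∃ ε : ℝ, 0 < ε ∧ ∀ q, b q + ε * v q < 0 := by
    have : ∀ᶠ ε in 𝓝[>] (0 : ℝ), ∀ q, b q + ε * v q < 0 := by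
      rw [Filter.eventually_all]
      intro q
      have h1 : Filter.Tendsto (fun ε : ℝ => b q + ε * v q) (𝓝[>] 0) (𝓝 (b q + 0 * v q)) :=
        (Continuous.tendsto (by fun_prop) 0).mono_left nhdsWithin_le_nhds
      exact h1.eventually_lt_const (by simpa [hb] using hneg q)
    obtain ⟨ε, h1, h2⟩ := (this.and self_mem_nhdsWithin).exists
    exact ⟨ε, h2, h1⟩
  -- The claim is that `p` is bounded above. The total rate has degree at most `deg Λ < m + deg Λ`
  -- and so does not affect the top coefficient.
  set p : Q → ℝ[X] := fun q => H.genPoly v m q + Polynomial.C (ε * v q) * Polynomial.X ^ m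
    + ∑ l, H.rate q l with hp
  have hXm : ∀ (c : ℝ) (r : ℝ[X]) (j : ℕ) (N : ℕ), r.natDegree + j ≤ N →
      (Polynomial.C c * Polynomial.X ^ j * r).natDegree ≤ N := by
    intro c r j N hN
    refine Polynomial.natDegree_mul_le.trans ?_
    have := Polynomial.natDegree_C_mul_X_pow_le c j
    omega
  have hdegp : ∀ q, (p q).natDegree ≤ m + H.degRate := by
    intro q
    refine Polynomial.natDegree_add_le_of_degree_le (Polynomial.natDegree_add_le_of_degree_le
      (Polynomial.natDegree_add_le_of_degree_le ?_ ?_) ?_) ?_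
    · exact hXm _ _ _ _ (by have := H.natDegree_f_le q; omega)
    · exact Polynomial.natDegree_sum_le_of_forall_le _ _ fun l _ =>
        hXm _ _ _ _ (by have := H.natDegree_rate_le q l; omega)
    · exact (Polynomial.natDegree_C_mul_X_pow_le _ _).trans (by omega)
    · exact Polynomial.natDegree_sum_le_of_forall_le _ _ fun l _ =>
        (H.natDegree_rate_le q l).trans (by omega)
  have hcoeff : ∀ q, (p q).coeff (m + H.degRate) < 0 := by
    intro q
    have h1 : (Polynomial.C (v q * m) * Polynomial.X ^ (m - 1) * H.f q).coeff (m + H.degRate)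
        = 0 := by
      refine Polynomial.coeff_eq_zero_of_natDegree_lt ((hXm _ _ _ (m - 1 + H.degRate) ?_).trans_lt
        (by omega))
      have := H.natDegree_f_le q; omega
    have h2 : (∑ l, H.rate q l).coeff (m + H.degRate) = 0 := by
      rw [Polynomial.finsetSum_coeff]
      exact Finset.sum_eq_zero fun l _ => Polynomial.coeff_eq_zero_of_natDegree_lt
        ((H.natDegree_rate_le q l).trans_lt (by omega))
    have h3 : (∑ l, Polynomial.C (H.γ q l ^ m * v l - v q) * Polynomial.X ^ m
        * H.rate q l).coeff (m + H.degRate) = b q := by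
      rw [Polynomial.finsetSum_coeff]
      simp only [hb, Finset.mul_sum, ← Finset.sum_sub_distrib]
      refine Finset.sum_congr rfl fun l _ => ?_
      rw [mul_assoc, Polynomial.coeff_C_mul, add_comm m, Polynomial.coeff_X_pow_mul, topCoeff]
      ring
    have h4 : (Polynomial.C (ε * v q) * Polynomial.X ^ m).coeff (m + H.degRate) ≤ ε * v q := by
      rw [Polynomial.coeff_C_mul, Polynomial.coeff_X_pow]
      have := mul_pos hε (hv q)
      split_ifs <;> simp [this.le]
    simp only [hp, genPoly, Polynomial.coeff_add, h1, h2, h3]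
    linarith [hε' q]
  choose C hC using fun q => Polynomial.exists_eval_le_of_coeff_neg (hdegp q) (hcoeff q)
  -- The division by `ε` writes the drift as `ε (K - V)`, with `K` the level of relaxation.
  refine ⟨v, ε, (∑ q, |C q|) / ε, hv, hε,
    div_nonneg (Finset.sum_nonneg fun _ _ => abs_nonneg _) hε.le, fun q x hx => ?_⟩
  rw [div_mul_cancel₀ _ hε.ne']
  have h1 := hC q x hx
  have h2 : C q ≤ ∑ q, |C q| := (le_abs_self _).trans
    (Finset.single_le_sum (f := fun q => |C q|) (fun _ _ => abs_nonneg _) (Finset.mem_univ q))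
  simp only [hp, Polynomial.eval_add, Polynomial.eval_mul, Polynomial.eval_C, Polynomial.eval_pow,
    Polynomial.eval_X, Polynomial.eval_finsetSum] at h1
  linarith

end SHS

/-! ### Orbits of the moment flow equations -/

namespace SHS

variable {Q : Type*}

open Classical in
/-- The expectation `E[1_θ(Q) p(X)]` of a polynomial. -/
noncomputable def polyMoment [MeasurableSpace Q] (ρ : Measure (Q × ℝ)) (θ : Q) (p : ℝ[X]) : ℝ :=
  ∫ y, (if y.1 = θ then p.eval y.2 else 0) ∂ρ

section PolyMoment

variable [MeasurableSpace Q] {ρ : Measure (Q × ℝ)}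

open Classical in
theorem integrable_ite_eval [MeasurableSingletonClass Q]
    (h : ∀ m : ℕ, Integrable (fun y : Q × ℝ => y.2 ^ m) ρ) (θ : Q)
    (p : ℝ[X]) : Integrable (fun y : Q × ℝ => if y.1 = θ then p.eval y.2 else 0) ρ := by
  have h1 : Integrable (fun y : Q × ℝ => p.eval y.2) ρ := by
    simp only [Polynomial.eval_eq_sum, Polynomial.sum_def]
    exact integrable_finsetSum _ fun i _ => (h i).const_mul _
  have h2 : MeasurableSet {y : Q × ℝ | y.1 = θ} := measurable_fst (measurableSet_singleton θ)
  exact h1.indicator h2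

theorem polyMoment_add [MeasurableSingletonClass Q]
    (h : ∀ m : ℕ, Integrable (fun y : Q × ℝ => y.2 ^ m) ρ) (θ : Q)
    (p r : ℝ[X]) : polyMoment ρ θ (p + r) = polyMoment ρ θ p + polyMoment ρ θ r := by
  rw [polyMoment, polyMoment, polyMoment,
    ← integral_add (integrable_ite_eval h θ p) (integrable_ite_eval h θ r)]
  refine integral_congr_ae (.of_forall fun y => ?_)
  by_cases hy : y.1 = θ <;> simp [hy]

theorem polyMoment_C_mul (θ : Q) (c : ℝ) (p : ℝ[X]) :
    polyMoment ρ θ (Polynomial.C c * p) = c * polyMoment ρ θ p := by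
  rw [polyMoment, polyMoment, ← integral_const_mul]
  refine integral_congr_ae (.of_forall fun y => ?_)
  by_cases hy : y.1 = θ <;> simp [hy]

theorem polyMoment_sum [MeasurableSingletonClass Q]
    (h : ∀ m : ℕ, Integrable (fun y : Q × ℝ => y.2 ^ m) ρ) (θ : Q)
    {ι : Type*} (s : Finset ι) (p : ι → ℝ[X]) :
    polyMoment ρ θ (∑ i ∈ s, p i) = ∑ i ∈ s, polyMoment ρ θ (p i) := by
  classical
  induction s using Finset.induction_on with
  | empty => simp [polyMoment]
  | insert a s ha ih => rw [Finset.sum_insert ha, Finset.sum_insert ha, polyMoment_add h, ih]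

theorem polyMoment_X_pow (m : ℕ) (θ : Q) :
    polyMoment ρ θ (Polynomial.X ^ m) = moment ρ m θ := by
  simp [polyMoment, moment]

theorem sum_mul_moment [MeasurableSingletonClass Q]
    (h : ∀ m : ℕ, Integrable (fun y : Q × ℝ => y.2 ^ m) ρ) (θ : Q) (j : ℕ)
    (p : ℝ[X]) : (p.sum fun a α => α * moment ρ (a + j) θ)
      = polyMoment ρ θ (Polynomial.X ^ j * p) := by
  conv_rhs => rw [p.as_sum_support_C_mul_X_pow, Finset.mul_sum, polyMoment_sum h]
  refine Finset.sum_congr rfl fun a _ => ?_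
  rw [mul_left_comm, polyMoment_C_mul, ← pow_add, polyMoment_X_pow, add_comm j]

theorem polyMoment_mono [MeasurableSingletonClass Q]
    (h : ∀ m : ℕ, Integrable (fun y : Q × ℝ => y.2 ^ m) ρ)
    (h0 : ∀ᵐ y ∂ρ, 0 ≤ y.2) (θ : Q) {p r : ℝ[X]} (hpr : ∀ x, 0 ≤ x → p.eval x ≤ r.eval x) :
    polyMoment ρ θ p ≤ polyMoment ρ θ r := by
  refine integral_mono_ae (integrable_ite_eval h θ p) (integrable_ite_eval h θ r) ?_
  filter_upwards [h0] with y hy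
  by_cases hθ : y.1 = θ <;> simp [hθ, hpr y.2 hy]

theorem moment_zero_le_one [IsProbabilityMeasure ρ] (θ : Q) : moment ρ 0 θ ≤ 1 := by
  classical
  have h : Integrable (fun _ : Q × ℝ => (1 : ℝ)) ρ := integrable_const 1
  have h1 : moment ρ 0 θ ≤ ∫ _, (1 : ℝ) ∂ρ := by
    refine integral_mono_of_nonneg (.of_forall fun y => ?_) h (.of_forall fun y => ?_)
    · by_cases hy : y.1 = θ <;> simp [hy]
    · by_cases hy : y.1 = θ <;> simp [hy]
  simpa using h1

theorem moment_nonneg (h0 : ∀ᵐ y ∂ρ, 0 ≤ y.2) (m : ℕ) (θ : Q) : 0 ≤ moment ρ m θ := by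
  refine integral_nonneg_of_ae ?_
  filter_upwards [h0] with y hy
  by_cases hθ : y.1 = θ <;> simp [hθ, pow_nonneg hy]

/-- The moment flow of a weighted `m`-th moment is the expectation of the generator. -/
theorem sum_mul_momentField [Fintype Q] [MeasurableSingletonClass Q] (H : SHS Q)
    (h : ∀ m : ℕ, Integrable (fun y : Q × ℝ => y.2 ^ m) ρ) (v : Q → ℝ) {m : ℕ} (hm : 1 ≤ m) :
    ∑ θ, v θ * H.momentField (moment ρ) m θ = ∑ q, polyMoment ρ q (H.genPoly v m q) := by
  have h1 : ∀ θ, ((H.f θ).sum fun a α => α * moment ρ (a + m - 1) θ)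
      = polyMoment ρ θ (Polynomial.X ^ (m - 1) * H.f θ) := by
    intro θ
    simp only [← sum_mul_moment h, Nat.add_sub_assoc hm]
  have h2 : ∀ k θ, ((H.rate k θ).sum fun b β => H.γ k θ ^ m * β * moment ρ (b + m) k)
      = H.γ k θ ^ m * polyMoment ρ k (Polynomial.X ^ m * H.rate k θ) := by
    intro k θ
    simp only [← sum_mul_moment h, Polynomial.sum_def, Finset.mul_sum, mul_assoc]
  simp only [momentField, h1, h2, sum_mul_moment h]
  simp only [genPoly, polyMoment_add h, polyMoment_sum h,
    mul_assoc, polyMoment_C_mul, mul_add, mul_sub, Finset.sum_add_distrib, Finset.sum_sub_distrib,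
    Finset.mul_sum, sub_mul]
  -- The gain of `θ` by jumps from `k` is regrouped by the state of origin, as in the generator.
  rw [Finset.sum_comm (f := fun θ k => v θ * (H.γ k θ ^ m * _)), add_sub_assoc]
  congr 2
  refine Finset.sum_congr rfl fun q _ => Finset.sum_congr rfl fun l _ => ?_
  ring

end PolyMoment

/-- Along an orbit of the moment flow equations the total `m`-th moment is bounded, if the
generator satisfies a drift condition. -/
theorem IsMomentOrbit.exists_totalMoment_le [Fintype Q] [MeasurableSpace Q]
    [MeasurableSingletonClass Q] {H : SHS Q} {ρ : ℝ → Measure (Q × ℝ)} (hρ : H.IsMomentOrbit ρ)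
    {m : ℕ} (hm : 1 ≤ m) {v : Q → ℝ} {ε K : ℝ} (hv : ∀ q, 0 < v q) (hε : 0 < ε) (hK : 0 ≤ K)
    (hdrift : ∀ q x, 0 ≤ x →
      (H.genPoly v m q).eval x ≤ K * ε - ε * (v q * x ^ m)) :
    ∃ C : ℝ, ∀ t, 0 ≤ t → |totalMoment (ρ t) m| ≤ C := by
  set Φ : ℝ → ℝ := fun t => ∑ θ, v θ * moment (ρ t) m θ with hΦ
  -- In each state the constant `K * ε` has expectation at most `K * ε`; the sum over the states
  -- costs the factor `card Q`.
  set K' : ℝ := K * Fintype.card Q with hK'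
  have hderiv : ∀ t, 0 ≤ t → HasDerivWithinAt Φ
      (∑ q, polyMoment (ρ t) q (H.genPoly v m q)) (Set.Ici 0) t := by
    intro t ht
    rw [← sum_mul_momentField H (hρ.integrable t ht) v hm]
    exact HasDerivWithinAt.fun_sum fun θ _ => (hρ.flow_eq t ht m hm θ).const_mul (v θ)
  have hle : ∀ t, 0 ≤ t →
      ∑ q, polyMoment (ρ t) q (H.genPoly v m q) ≤ K' * ε - ε * Φ t := by
    intro t ht
    have := hρ.isProbabilityMeasure t ht
    have hint := hρ.integrable t ht
    have h1 : ∀ q, polyMoment (ρ t) q (H.genPoly v m q)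
        ≤ K * ε - ε * (v q * moment (ρ t) m q) := by
      intro q
      have h2 := polyMoment_mono hint (hρ.nonneg t ht) q (p := H.genPoly v m q)
        (r := Polynomial.C (K * ε) * Polynomial.X ^ 0
          + Polynomial.C (-(ε * v q)) * Polynomial.X ^ m)
        (fun x hx => (hdrift q x hx).trans (by simp; linarith))
      rw [polyMoment_add hint, polyMoment_C_mul, polyMoment_C_mul, polyMoment_X_pow,
        polyMoment_X_pow] at h2
      have h3 := mul_le_mul_of_nonneg_left (moment_zero_le_one (ρ := ρ t) q)
        (mul_nonneg hK hε.le)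
      linarith
    refine (Finset.sum_le_sum fun q _ => h1 q).trans (le_of_eq ?_)
    simp only [Finset.sum_sub_distrib, Finset.sum_const, Finset.card_univ, nsmul_eq_mul, hK', hΦ,
      Finset.mul_sum]
    ring
  -- This is `Φ' ≤ ε (K' - Φ)` with the integrating factor `exp (ε t)`.
  have hanti : AntitoneOn (fun t => Real.exp (ε * t) * (Φ t - K')) (Set.Ici 0) := by
    have hd : ∀ t, 0 ≤ t → HasDerivWithinAt (fun t => Real.exp (ε * t) * (Φ t - K'))
        (Real.exp (ε * t) * (ε * 1) * (Φ t - K')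
          + Real.exp (ε * t) * ∑ q, polyMoment (ρ t) q (H.genPoly v m q)) (Set.Ici 0) t := by
      intro t ht
      exact (((hasDerivAt_id t).const_mul ε).exp.hasDerivWithinAt).mul
        ((hderiv t ht).sub_const K')
    refine antitoneOn_of_hasDerivWithinAt_nonpos (convex_Ici 0)
      (fun t ht => (hd t ht).continuousWithinAt)
      (fun t ht => (hd t (interior_subset ht)).mono interior_subset) fun t ht => ?_
    have h1 := hle t (interior_subset ht)
    have h2 := Real.exp_pos (ε * t)
    nlinarith
  refine ⟨(K' + |Φ 0 - K'|) * ∑ q, (v q)⁻¹, fun t ht => ?_⟩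
  have hm0 := moment_nonneg (hρ.nonneg t ht) m
  have hΦt : Φ t ≤ K' + |Φ 0 - K'| := by
    have h1 := hanti (Set.mem_Ici.2 le_rfl) (Set.mem_Ici.2 ht) ht
    simp only [mul_zero, Real.exp_zero, one_mul] at h1
    have h2 : 1 ≤ Real.exp (ε * t) := Real.one_le_exp (mul_nonneg hε.le ht)
    by_contra! h3
    have h4 := le_abs_self (Φ 0 - K')
    have h5 := abs_nonneg (Φ 0 - K')
    nlinarith
  rw [totalMoment, abs_of_nonneg (Finset.sum_nonneg fun θ _ => hm0 θ)]
  calc ∑ θ, moment (ρ t) m θ ≤ ∑ θ, v θ * moment (ρ t) m θ * ∑ q, (v q)⁻¹ := by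
        refine Finset.sum_le_sum fun θ _ => ?_
        have h1 : (v θ)⁻¹ ≤ ∑ q, (v q)⁻¹ := Finset.single_le_sum (f := fun q => (v q)⁻¹)
          (fun q _ => (inv_pos.2 (hv q)).le) (Finset.mem_univ θ)
        calc moment (ρ t) m θ = v θ * moment (ρ t) m θ * (v θ)⁻¹ := by
              field_simp [(hv θ).ne']
          _ ≤ _ := mul_le_mul_of_nonneg_left h1 (mul_nonneg (hv θ).le (hm0 θ))
    _ = Φ t * ∑ q, (v q)⁻¹ := by rw [← Finset.sum_mul]
    _ ≤ _ := mul_le_mul_of_nonneg_right hΦt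
        (Finset.sum_nonneg fun q _ => (inv_pos.2 (hv q)).le)

end SHS

/-! ### Flows of polynomial vector fields by truncation -/

section GlobalFlow

variable {g : ℝ → ℝ} {K L : ℝ≥0}

/-- The distance of two solutions of an autonomous Lipschitz equation grows at most
exponentially. -/
theorem LipschitzWith.dist_solutions_le (hg : LipschitzWith K g) {y z : ℝ → ℝ} {T : ℝ}
    (hy : ∀ s ∈ Set.Icc 0 T, HasDerivWithinAt y (g (y s)) (Set.Icc 0 T) s)
    (hz : ∀ s ∈ Set.Icc 0 T, HasDerivWithinAt z (g (z s)) (Set.Icc 0 T) s) :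
    ∀ s ∈ Set.Icc 0 T, dist (y s) (z s) ≤ dist (y 0) (z 0) * Real.exp (K * s) := by
  intro s hs
  have key : ∀ {u : ℝ → ℝ}, (∀ s ∈ Set.Icc 0 T, HasDerivWithinAt u (g (u s)) (Set.Icc 0 T) s) →
      ∀ s ∈ Set.Ico 0 T, HasDerivWithinAt u (g (u s)) (Set.Ici s) s := fun h s hs =>
    (h s ⟨hs.1, hs.2.le⟩).mono_of_mem_nhdsWithin (Icc_mem_nhdsGE_of_mem hs)
  have := dist_le_of_trajectories_ODE (v := fun _ => g) (fun _ => hg)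
    (fun s hs => (hy s hs).continuousWithinAt) (key hy)
    (fun s hs => (hz s hs).continuousWithinAt) (key hz) le_rfl s hs
  simpa using this

theorem LipschitzWith.eqOn_of_solutions (hg : LipschitzWith K g) {y z : ℝ → ℝ} {T : ℝ}
    (hy : ∀ s ∈ Set.Icc 0 T, HasDerivWithinAt y (g (y s)) (Set.Icc 0 T) s)
    (hz : ∀ s ∈ Set.Icc 0 T, HasDerivWithinAt z (g (z s)) (Set.Icc 0 T) s) (h0 : y 0 = z 0) :
    ∀ s ∈ Set.Icc 0 T, y s = z s := by
  intro s hs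
  have := hg.dist_solutions_le hy hz s hs
  rw [h0, dist_self, zero_mul] at this
  exact dist_le_zero.1 this

/-- A bounded Lipschitz vector field on the line has a continuous semiflow. -/
theorem LipschitzWith.exists_semiflow (hg : LipschitzWith K g) (hL : ∀ z, |g z| ≤ L) :
    ∃ Φ : ℝ → ℝ → ℝ, Continuous Φ.uncurry ∧ (∀ x, Φ x 0 = x) ∧
      ∀ x t, 0 ≤ t → HasDerivWithinAt (Φ x) (g (Φ x t)) (Set.Ici 0) t := by
  have hloc : ∀ (x : ℝ) (T : ℝ≥0), ∃ y : ℝ → ℝ, y 0 = x ∧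
      ∀ s ∈ Set.Icc 0 (T : ℝ), HasDerivWithinAt y (g (y s)) (Set.Icc 0 (T : ℝ)) s := by
    intro x T
    -- At speed at most `L` a solution stays within `L * T` of `x`, so this radius reaches the whole
    -- of `[0, T]`.
    have hPL : IsPicardLindelof (fun _ => g) (tmin := 0) (tmax := (T : ℝ))
        ⟨0, le_rfl, T.2⟩ x (L * T) 0 L K :=
      IsPicardLindelof.of_time_independent (fun z _ => hL z) hg.lipschitzOnWith (by simp)
    exact hPL.exists_eq_forall_mem_Icc_hasDerivWithinAt₀
  choose Y hY0 hY using hloc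
  have hmono : ∀ {u : ℝ → ℝ} {S T : ℝ}, S ≤ T →
      (∀ s ∈ Set.Icc 0 T, HasDerivWithinAt u (g (u s)) (Set.Icc 0 T) s) →
      ∀ s ∈ Set.Icc 0 S, HasDerivWithinAt u (g (u s)) (Set.Icc 0 S) s := fun hST h s hs =>
    (h s ⟨hs.1, hs.2.trans hST⟩).mono (Set.Icc_subset_Icc_right hST)
  -- The solution on `[0, t]` is read off at its endpoint. Negative times are sent to `0`, so that
  -- `Φ` is continuous on the whole line.
  set Φ : ℝ → ℝ → ℝ := fun x t => Y x t.toNNReal t.toNNReal with hΦ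
  have hΦY : ∀ x (T : ℝ≥0), ∀ s ∈ Set.Icc 0 (T : ℝ), Φ x s = Y x T s := by
    intro x T s hs
    have h1 : (s.toNNReal : ℝ) = s := Real.coe_toNNReal s hs.1
    have h2 := hg.eqOn_of_solutions (hY x s.toNNReal)
      (hmono (by rw [h1]; exact hs.2) (hY x T)) (by rw [hY0, hY0]) s.toNNReal
      ⟨s.toNNReal.2, le_rfl⟩
    simpa only [hΦ, h1] using h2
  have hΦd : ∀ x t, 0 ≤ t → HasDerivWithinAt (Φ x) (g (Φ x t)) (Set.Ici 0) t := by
    intro x t ht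
    obtain ⟨T, hT⟩ : ∃ T : ℝ≥0, (T : ℝ) = t + 1 := ⟨⟨t + 1, by positivity⟩, rfl⟩
    have htT : t ∈ Set.Icc 0 (T : ℝ) := ⟨ht, by linarith⟩
    have h1 : HasDerivWithinAt (Φ x) (g (Φ x t)) (Set.Icc 0 (T : ℝ)) t := by
      rw [hΦY x T t htT]
      exact (hY x T t htT).congr (hΦY x T) (hΦY x T t htT)
    refine h1.mono_of_mem_nhdsWithin ?_
    rw [← Set.Ici_inter_Iic]
    exact Filter.inter_mem self_mem_nhdsWithin
      (mem_nhdsWithin_of_mem_nhds (Iic_mem_nhds (by linarith)))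
  have hΦIcc : ∀ x T, ∀ s ∈ Set.Icc 0 T, HasDerivWithinAt (Φ x) (g (Φ x s)) (Set.Icc 0 T) s :=
    fun x T s hs => (hΦd x s hs.1).mono Set.Icc_subset_Ici_self
  have hΦ0 : ∀ x, Φ x 0 = x := by
    intro x; simp [hΦ, hY0]
  have hΦmax : ∀ x t, Φ x t = Φ x (max t 0) := by
    intro x t
    have : (max t 0).toNNReal = t.toNNReal := by
      rcases le_total t 0 with h | h <;> simp [h, Real.toNNReal_of_nonpos]
    simp only [hΦ, this]
  refine ⟨Φ, ?_, hΦ0, hΦd⟩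
  -- Lipschitz in time with the uniform constant `L`, and continuous in space by Gronwall.
  refine continuous_prod_of_continuous_lipschitzWith' _ L (fun x => ?_) fun t => ?_
  · have h1 : LipschitzOnWith L (Φ x) (Set.Ici 0) :=
      Convex.lipschitzOnWith_of_nnnorm_hasDerivWithin_le (convex_Ici 0)
        (fun s hs => hΦd x s hs) (fun s _ => by
          rw [← NNReal.coe_le_coe, coe_nnnorm]; exact hL _)
    have h2 : (fun t => Function.uncurry Φ (x, t)) = Φ x ∘ fun t => max t 0 := by
      funext t
      simpa using hΦmax x t
    rw [h2, ← lipschitzOnWith_univ, ← mul_one L]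
    exact h1.comp (LipschitzWith.id.max_const 0).lipschitzOnWith fun t _ =>
      Set.mem_Ici.2 (show (0 : ℝ) ≤ max (id t) 0 from le_max_right _ _)
  · have h1 : LipschitzWith (Real.exp (K * max t 0)).toNNReal fun x => Φ x t := by
      refine LipschitzWith.of_dist_le_mul fun x z => ?_
      rw [hΦmax x, hΦmax z, Real.coe_toNNReal _ (Real.exp_pos _).le, mul_comm]
      have := hg.dist_solutions_le (hΦIcc x (max t 0)) (hΦIcc z (max t 0)) (max t 0)
        ⟨le_max_right _ _, le_rfl⟩
      rwa [hΦ0, hΦ0] at this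
    exact h1.continuous

/-- A Lipschitz vector field that does not point out of `[0, ∞)` at `0` leaves `[0, ∞)`
invariant. -/
theorem LipschitzWith.solution_nonneg (hg : LipschitzWith K g) (hg0 : 0 ≤ g 0) {y : ℝ → ℝ} {T : ℝ}
    (hy : ∀ s ∈ Set.Icc 0 T, HasDerivWithinAt y (g (y s)) (Set.Icc 0 T) s) (h0 : 0 ≤ y 0) :
    ∀ s ∈ Set.Icc 0 T, 0 ≤ y s := by
  intro s hs
  -- Where `-y` touches the barrier, `-g y ≤ K |y| < (K + 1) |y|` by the Lipschitz bound and `0 ≤ g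
  -- 0`, so the barrier grows faster.
  have key : ∀ δ : ℝ, 0 < δ → -y s ≤ δ * Real.exp ((K + 1) * s) := by
    intro δ hδ
    refine image_le_of_deriv_right_lt_deriv_boundary (f := fun s => -y s)
      (f' := fun s => -g (y s)) (B := fun s => δ * Real.exp ((K + 1) * s))
      (B' := fun s => δ * (Real.exp ((K + 1) * s) * ((K + 1) * 1)))
      (fun s hs => (hy s hs).continuousWithinAt.neg) (fun s hs => ?_) (by simp; linarith)
      (fun s => (((hasDerivAt_id s).const_mul _).exp).const_mul δ) (fun s hs heq => ?_) hs
    · exact ((hy s ⟨hs.1, hs.2.le⟩).mono_of_mem_nhdsWithin (Icc_mem_nhdsGE_of_mem hs)).neg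
    · have h1 := hg.dist_le_mul (y s) 0
      have h2 : 0 < δ * Real.exp ((K + 1) * s) := mul_pos hδ (Real.exp_pos _)
      rw [Real.dist_eq, Real.dist_eq, sub_zero, abs_of_nonpos (by linarith : y s ≤ 0), heq] at h1
      have h3 := neg_abs_le (g (y s) - g 0)
      linarith
  by_contra! hneg
  have h1 := key (-y s / (2 * Real.exp ((K + 1) * s)))
    (div_pos (by linarith) (mul_pos two_pos (Real.exp_pos _)))
  have h2 : -y s / (2 * Real.exp ((K + 1) * s)) * Real.exp ((K + 1) * s) = -y s / 2 := by
    field_simp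
  linarith

end GlobalFlow

/-- The polynomial vector field `p`, made constant outside of `[-n, n]`. -/
noncomputable def truncField (p : ℝ[X]) (n : ℕ) (z : ℝ) : ℝ :=
  p.eval (max (-n : ℝ) (min n z))

theorem truncField_of_abs_le {p : ℝ[X]} {n : ℕ} {z : ℝ} (hz : |z| ≤ n) :
    truncField p n z = p.eval z := by
  rw [abs_le] at hz
  rw [truncField, min_eq_right hz.2, max_eq_right hz.1]

theorem exists_lipschitzWith_truncField (p : ℝ[X]) (n : ℕ) :
    ∃ K, LipschitzWith K (truncField p n) := by
  obtain ⟨K, hK⟩ := (p.contDiff_aeval (𝕜 := ℝ) 1).contDiffOn.exists_lipschitzOnWith one_ne_zero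
    (convex_Icc (-n : ℝ) n) isCompact_Icc
  have h1 : LipschitzWith 1 fun z : ℝ => max (-n : ℝ) (min n z) :=
    (LipschitzWith.id.const_min _).const_max _
  refine ⟨K * 1, ?_⟩
  rw [← lipschitzOnWith_univ]
  refine hK.comp h1.lipschitzOnWith fun z _ => ⟨le_max_left _ _, max_le ?_ (min_le_left _ _)⟩
  have : (0 : ℝ) ≤ n := n.cast_nonneg
  linarith

theorem exists_abs_truncField_le (p : ℝ[X]) (n : ℕ) :
    ∃ L : ℝ≥0, ∀ z, |truncField p n z| ≤ L := by
  obtain ⟨C, hC⟩ := (isCompact_Icc (a := (-n : ℝ)) (b := n)).exists_bound_of_continuousOn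
    (p.continuous.continuousOn)
  refine ⟨C.toNNReal, fun z => le_trans (hC _ ⟨le_max_left _ _, max_le ?_ (min_le_left _ _)⟩)
    (Real.le_coe_toNNReal C)⟩
  have : (0 : ℝ) ≤ n := n.cast_nonneg
  linarith

theorem exists_truncFlow (p : ℝ[X]) (n : ℕ) :
    ∃ Φ : ℝ → ℝ → ℝ, Continuous Φ.uncurry ∧ (∀ x, Φ x 0 = x) ∧
      ∀ x t, 0 ≤ t → HasDerivWithinAt (Φ x) (truncField p n (Φ x t)) (Set.Ici 0) t := by
  obtain ⟨K, hK⟩ := exists_lipschitzWith_truncField p n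
  obtain ⟨L, hL⟩ := exists_abs_truncField_le p n
  exact hK.exists_semiflow hL

/-- The semiflow of the truncated vector field. -/
noncomputable def truncFlow (p : ℝ[X]) (n : ℕ) : ℝ → ℝ → ℝ := (exists_truncFlow p n).choose

theorem continuous_truncFlow (p : ℝ[X]) (n : ℕ) :
    Continuous fun z : ℝ × ℝ => truncFlow p n z.1 z.2 :=
  (exists_truncFlow p n).choose_spec.1

theorem continuous_truncFlow_right (p : ℝ[X]) (n : ℕ) (x : ℝ) : Continuous (truncFlow p n x) :=
  (continuous_truncFlow p n).comp (by fun_prop : Continuous fun t : ℝ => (x, t))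

theorem truncFlow_zero (p : ℝ[X]) (n : ℕ) (x : ℝ) : truncFlow p n x 0 = x :=
  (exists_truncFlow p n).choose_spec.2.1 x

theorem hasDerivWithinAt_truncFlow (p : ℝ[X]) (n : ℕ) (x T : ℝ) : ∀ s ∈ Set.Icc 0 T,
    HasDerivWithinAt (truncFlow p n x) (truncField p n (truncFlow p n x s)) (Set.Icc 0 T) s :=
  fun s hs => ((exists_truncFlow p n).choose_spec.2.2 x s hs.1).mono Set.Icc_subset_Ici_self

/-- The truncated trajectory of `x` stays within `[-n, n]` up to time `t`. -/
def StaysWithin (p : ℝ[X]) (n : ℕ) (x t : ℝ) : Prop :=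
  ∀ s ∈ Set.Icc 0 t, |truncFlow p n x s| ≤ n

theorem StaysWithin.isSolutionOn {p : ℝ[X]} {n : ℕ} {x t : ℝ} (h : StaysWithin p n x t) :
    IsSolutionOn p x t (truncFlow p n x) := by
  refine ⟨truncFlow_zero p n x, fun s hs => ?_⟩
  rw [← truncField_of_abs_le (h s hs)]
  exact hasDerivWithinAt_truncFlow p n x t s hs

theorem IsSolutionOn.mono {p : ℝ[X]} {x s t : ℝ} {y : ℝ → ℝ} (h : IsSolutionOn p x t y)
    (hst : s ≤ t) : IsSolutionOn p x s y :=
  ⟨h.1, fun u hu => (h.2 u ⟨hu.1, hu.2.trans hst⟩).mono (Set.Icc_subset_Icc_right hst)⟩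

theorem IsSolutionOn.eqOn_truncFlow {p : ℝ[X]} {n : ℕ} {x t : ℝ} {y : ℝ → ℝ}
    (h : IsSolutionOn p x t y) (hn : ∀ s ∈ Set.Icc 0 t, |y s| ≤ n) :
    ∀ s ∈ Set.Icc 0 t, y s = truncFlow p n x s := by
  obtain ⟨K, hK⟩ := exists_lipschitzWith_truncField p n
  refine hK.eqOn_of_solutions (fun s hs => ?_) (hasDerivWithinAt_truncFlow p n x t)
    (by rw [h.1, truncFlow_zero])
  rw [truncField_of_abs_le (hn s hs)]
  exact h.2 s hs

theorem IsSolutionOn.exists_abs_le {p : ℝ[X]} {x t : ℝ} {y : ℝ → ℝ} (h : IsSolutionOn p x t y) :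
    ∃ n : ℕ, ∀ s ∈ Set.Icc 0 t, |y s| ≤ n := by
  obtain ⟨C, hC⟩ := (isCompact_Icc (a := (0 : ℝ)) (b := t)).exists_bound_of_continuousOn
    (fun s hs => (h.2 s hs).continuousWithinAt)
  obtain ⟨n, hn⟩ := exists_nat_ge C
  exact ⟨n, fun s hs => (hC s hs).trans hn⟩

theorem IsSolutionOn.eqOn {p : ℝ[X]} {x t : ℝ} {y z : ℝ → ℝ}
    (hy : IsSolutionOn p x t y) (hz : IsSolutionOn p x t z) : ∀ s ∈ Set.Icc 0 t, y s = z s := by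
  obtain ⟨n, hn⟩ := hy.exists_abs_le
  obtain ⟨k, hk⟩ := hz.exists_abs_le
  intro s hs
  have h1 : (n : ℝ) ≤ (max n k : ℕ) := by exact_mod_cast le_max_left n k
  have h2 : (k : ℝ) ≤ (max n k : ℕ) := by exact_mod_cast le_max_right n k
  rw [hy.eqOn_truncFlow (n := max n k) (fun s hs => (hn s hs).trans h1) s hs,
    hz.eqOn_truncFlow (n := max n k) (fun s hs => (hk s hs).trans h2) s hs]

theorem Survives.mono {p : ℝ[X]} {x s t : ℝ} (h : Survives p x t) (hst : s ≤ t) :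
    Survives p x s := h.imp fun _ hy => hy.mono hst

theorem survives_zero (p : ℝ[X]) (x : ℝ) : Survives p x 0 :=
  ⟨fun _ => x, rfl, fun s hs => by
    obtain rfl : s = 0 := le_antisymm hs.2 hs.1
    rw [Set.Icc_self]
    exact HasFDerivWithinAt.of_subsingleton Set.subsingleton_singleton⟩

/-- `flow` picks a separate solution for each time; uniqueness makes these choices agree. -/
theorem Survives.isSolutionOn_flow {p : ℝ[X]} {x t : ℝ} (h : Survives p x t) :
    IsSolutionOn p x t (flow p x) := by
  obtain ⟨y, hy⟩ := id h
  have heq : ∀ s ∈ Set.Icc 0 t, flow p x s = y s := by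
    intro s hs
    have hs' := h.mono hs.2
    rw [flow, dif_pos hs']
    exact hs'.choose_spec.eqOn (hy.mono hs.2) s ⟨hs.1, le_rfl⟩
  refine ⟨?_, fun s hs => ?_⟩
  · rw [flow, dif_pos (survives_zero p x)]
    exact (survives_zero p x).choose_spec.1
  · rw [heq s hs]
    exact (hy.2 s hs).congr heq (heq s hs)

theorem flow_zero (p : ℝ[X]) (x : ℝ) : flow p x 0 = x :=
  (survives_zero p x).isSolutionOn_flow.1

theorem StaysWithin.survives {p : ℝ[X]} {n : ℕ} {x t : ℝ} (h : StaysWithin p n x t) :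
    Survives p x t := ⟨_, h.isSolutionOn⟩

theorem StaysWithin.flow_eq {p : ℝ[X]} {n : ℕ} {x t : ℝ} (h : StaysWithin p n x t) :
    ∀ s ∈ Set.Icc 0 t, flow p x s = truncFlow p n x s :=
  h.survives.isSolutionOn_flow.eqOn h.isSolutionOn

/-- A solution on a compact interval is bounded. Questions about the partially defined flow thus
reduce to countably many continuous truncated flows. -/
theorem survives_iff_exists_staysWithin {p : ℝ[X]} {x t : ℝ} :
    Survives p x t ↔ ∃ n, StaysWithin p n x t := by
  refine ⟨fun h => ?_, fun ⟨n, hn⟩ => hn.survives⟩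
  obtain ⟨y, hy⟩ := h
  obtain ⟨n, hn⟩ := hy.exists_abs_le
  exact ⟨n, fun s hs => hy.eqOn_truncFlow hn s hs ▸ hn s hs⟩

theorem truncFlow_nonneg {p : ℝ[X]} (hp : 0 ≤ p.eval 0) (n : ℕ) {x t : ℝ} (hx : 0 ≤ x)
    (ht : 0 ≤ t) : 0 ≤ truncFlow p n x t := by
  obtain ⟨K, hK⟩ := exists_lipschitzWith_truncField p n
  refine hK.solution_nonneg ?_ (hasDerivWithinAt_truncFlow p n x t)
    (by rwa [truncFlow_zero]) t ⟨ht, le_rfl⟩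
  rwa [truncField_of_abs_le (by simp)]

theorem Survives.flow_nonneg {p : ℝ[X]} (hp : 0 ≤ p.eval 0) {x t : ℝ} (h : Survives p x t)
    (hx : 0 ≤ x) : ∀ s ∈ Set.Icc 0 t, 0 ≤ flow p x s := by
  obtain ⟨n, hn⟩ := survives_iff_exists_staysWithin.1 h
  intro s hs
  rw [hn.flow_eq s hs]
  exact truncFlow_nonneg hp n hx hs.1

open Filter Topology in
/-- The set of times at which a trajectory exists is open to the right. -/
theorem Survives.exists_gt {p : ℝ[X]} {x t : ℝ} (h : Survives p x t) (ht : 0 ≤ t) :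
    ∃ u, t < u ∧ Survives p x u := by
  obtain ⟨n, hn⟩ := h.isSolutionOn_flow.exists_abs_le
  -- The gap between the bound `n` and the truncation level `n + 1` leaves room to continue a little
  -- beyond `t`.
  have heq := h.isSolutionOn_flow.eqOn_truncFlow (n := n + 1)
    (fun s hs => (hn s hs).trans (by simp))
  have hlt : ∀ s ∈ Set.Icc 0 t, |truncFlow p (n + 1) x s| < (n + 1 : ℕ) := by
    intro s hs
    rw [← heq s hs]
    exact (hn s hs).trans_lt (by simp)
  have hev : ∀ᶠ u in 𝓝 t, |truncFlow p (n + 1) x u| < (n + 1 : ℕ) :=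
    ((continuous_truncFlow_right p (n + 1) x).abs.tendsto t).eventually_lt_const
      (hlt t ⟨ht, le_rfl⟩)
  obtain ⟨δ, hδ, hball⟩ := Metric.eventually_nhds_iff.1 hev
  refine ⟨t + δ / 2, by linarith, StaysWithin.survives (n := n + 1) fun s hs => ?_⟩
  rcases le_total s t with hst | hst
  · exact (hlt s ⟨hs.1, hst⟩).le
  · refine (hball ?_).le
    rw [Real.dist_eq, abs_of_nonneg (by linarith)]
    linarith [hs.2]

open Topology in
/-- A nonnegative trajectory that does not exist up to time `t` runs through every value above its
initial value. -/
theorem exists_flow_eq_of_not_survives {p : ℝ[X]} (hp : 0 ≤ p.eval 0) {x t : ℝ} (hx : 0 ≤ x)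
    (h : ¬Survives p x t) {k : ℕ} (hk : x < k) :
    ∃ T, 0 ≤ T ∧ T ≤ t ∧ Survives p x T ∧ flow p x T = k := by
  -- If level `k` were never reached, the truncation would never be felt and the trajectory would
  -- survive. The time sought is the first passage through `k`.
  have h1 : ∃ s ∈ Set.Icc 0 t, (k : ℝ) ≤ truncFlow p k x s := by
    by_contra! hcon
    refine h (StaysWithin.survives (n := k) fun s hs => ?_)
    rw [abs_of_nonneg (truncFlow_nonneg hp k hx hs.1)]
    exact (hcon s hs).le
  set A : Set ℝ := {s ∈ Set.Icc 0 t | (k : ℝ) ≤ truncFlow p k x s} with hA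
  have hAc : IsClosed A := isClosed_Icc.inter
    (isClosed_Ici.preimage (continuous_truncFlow_right p k x))
  have hAb : BddBelow A := ⟨0, fun s hs => hs.1.1⟩
  have hT := hAc.csInf_mem h1 hAb
  set T := sInf A with hTdef
  have hlt : ∀ s, 0 ≤ s → s < T → truncFlow p k x s < k := by
    intro s hs hsT
    by_contra! hcon
    exact absurd (csInf_le hAb ⟨⟨hs, hsT.le.trans hT.1.2⟩, hcon⟩) (not_le.2 hsT)
  have hTpos : 0 < T := by
    refine lt_of_le_of_ne hT.1.1 fun h0 => ?_
    have := hT.2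
    rw [← h0, truncFlow_zero] at this
    linarith
  have hTk : truncFlow p k x T = k := by
    refine le_antisymm ?_ hT.2
    refine le_of_tendsto (x := 𝓝[<] T) (f := truncFlow p k x)
      (((continuous_truncFlow_right p k x).tendsto T).mono_left nhdsWithin_le_nhds) ?_
    filter_upwards [Ioo_mem_nhdsLT hTpos] with s hs using (hlt s hs.1.le hs.2).le
  have hst : StaysWithin p k x T := by
    intro s hs
    rw [abs_of_nonneg (truncFlow_nonneg hp k hx hs.1)]
    rcases hs.2.eq_or_lt with h2 | h2
    · rw [h2, hTk]
    · exact (hlt s hs.1 h2).le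
  exact ⟨T, hTpos.le, hT.1.2, hst.survives, by rw [hst.flow_eq T ⟨hTpos.le, le_rfl⟩, hTk]⟩

theorem isClosed_staysWithin (p : ℝ[X]) (n : ℕ) :
    IsClosed {z : ℝ × ℝ≥0 | StaysWithin p n z.1 z.2} := by
  -- The substitution `s = σ t` makes the index set `[0, 1]` independent of `t`.
  have : {z : ℝ × ℝ≥0 | StaysWithin p n z.1 z.2}
      = ⋂ σ ∈ Set.Icc (0 : ℝ) 1, {z : ℝ × ℝ≥0 | |truncFlow p n z.1 (σ * z.2)| ≤ n} := by
    ext z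
    simp only [Set.mem_ofPred_eq, Set.mem_iInter]
    refine ⟨fun h σ hσ => h _ ⟨mul_nonneg hσ.1 z.2.coe_nonneg,
      mul_le_of_le_one_left z.2.coe_nonneg hσ.2⟩,
      fun h s hs => ?_⟩
    rcases z.2.coe_nonneg.eq_or_lt with h0 | h0
    · have hs0 : s = 0 := le_antisymm (hs.2.trans h0.ge) hs.1
      simpa [hs0] using h 0 ⟨le_rfl, zero_le_one⟩
    · have := h (s / z.2) ⟨div_nonneg hs.1 h0.le, div_le_one_of_le₀ hs.2 h0.le⟩
      rwa [div_mul_cancel₀ _ (ne_of_gt h0)] at this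
  rw [this]
  refine isClosed_biInter fun σ _ => isClosed_le ?_ continuous_const
  exact ((continuous_truncFlow p n).comp (by fun_prop :
    Continuous fun z : ℝ × ℝ≥0 => (z.1, σ * (z.2 : ℝ)))).abs

theorem measurableSet_survives (p : ℝ[X]) :
    MeasurableSet {z : ℝ × ℝ≥0 | Survives p z.1 z.2} := by
  simp only [survives_iff_exists_staysWithin, Set.ofPred_exists]
  exact MeasurableSet.iUnion fun n => (isClosed_staysWithin p n).measurableSet

/-- The closed sets `StaysWithin p n` cover the set of survival, and on each of them the flow is a
continuous truncated flow; elsewhere it has the dummy value `0`. -/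
theorem measurable_flow (p : ℝ[X]) : Measurable fun z : ℝ × ℝ≥0 => flow p z.1 z.2 := by
  intro B hB
  have hm : ∀ n, Measurable fun z : ℝ × ℝ≥0 => truncFlow p n z.1 z.2 := fun n =>
    ((continuous_truncFlow p n).comp (by fun_prop :
      Continuous fun z : ℝ × ℝ≥0 => (z.1, (z.2 : ℝ)))).measurable
  have : (fun z : ℝ × ℝ≥0 => flow p z.1 z.2) ⁻¹' B
      = (⋃ n, {z : ℝ × ℝ≥0 | StaysWithin p n z.1 z.2}
          ∩ (fun z : ℝ × ℝ≥0 => truncFlow p n z.1 z.2) ⁻¹' B)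
        ∪ ({z : ℝ × ℝ≥0 | Survives p z.1 z.2}ᶜ ∩ {_z | (0 : ℝ) ∈ B}) := by
    ext z
    simp only [Set.mem_preimage, Set.mem_union, Set.mem_iUnion, Set.mem_inter_iff,
      Set.mem_ofPred_eq, Set.mem_compl_iff]
    by_cases hz : Survives p z.1 z.2
    · have heq : ∀ n, StaysWithin p n z.1 z.2 → flow p z.1 z.2 = truncFlow p n z.1 z.2 :=
        fun n hn => hn.flow_eq _ ⟨z.2.coe_nonneg, le_rfl⟩
      refine ⟨fun h => ?_, ?_⟩
      · obtain ⟨n, hn⟩ := survives_iff_exists_staysWithin.1 hz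
        exact Or.inl ⟨n, hn, heq n hn ▸ h⟩
      · rintro (⟨n, hn, h⟩ | ⟨h, -⟩)
        · rwa [heq n hn]
        · exact absurd hz h
    · have h0 : flow p z.1 z.2 = 0 := by rw [flow, dif_neg hz]
      rw [h0]
      refine ⟨fun h => Or.inr ⟨hz, h⟩, ?_⟩
      rintro (⟨n, hn, h⟩ | ⟨-, h⟩)
      · exact absurd hn.survives hz
      · exact h
  rw [this]
  refine (MeasurableSet.iUnion fun n => (isClosed_staysWithin p n).measurableSet.inter
    (hm n hB)).union ((measurableSet_survives p).compl.inter (MeasurableSet.const _))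

/-! ### Measurability of the jump mechanism -/

namespace SHS

variable {Q : Type*}

/-- Closed as the projection of a closed set along the compact time interval `[0, c]`. -/
theorem isClosed_exists_le_fire (p r : ℝ[X]) (n : ℕ) (c : ℝ≥0) :
    IsClosed {z : ℝ × ℝ | ∃ t : ℝ≥0, t ≤ c ∧ StaysWithin p n z.1 t ∧
      z.2 ≤ ∫ u in (0 : ℝ)..t, r.eval (truncFlow p n z.1 u)} := by
  set C : Set ((ℝ × ℝ) × Set.Icc (0 : ℝ≥0) c) := {y | StaysWithin p n y.1.1 (y.2 : ℝ≥0) ∧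
    y.1.2 ≤ ∫ u in (0 : ℝ)..(y.2 : ℝ≥0), r.eval (truncFlow p n y.1.1 u)} with hC
  have hCc : IsClosed C := by
    refine IsClosed.inter ?_ (isClosed_le continuous_fst.snd ?_)
    · exact (isClosed_staysWithin p n).preimage (by fun_prop :
        Continuous fun y : (ℝ × ℝ) × Set.Icc (0 : ℝ≥0) c => (y.1.1, (y.2 : ℝ≥0)))
    · refine intervalIntegral.continuous_parametric_intervalIntegral_of_continuous
        (f := fun (y : (ℝ × ℝ) × Set.Icc (0 : ℝ≥0) c) u => r.eval (truncFlow p n y.1.1 u))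
        ?_ (by fun_prop)
      exact r.continuous.comp ((continuous_truncFlow p n).comp (by fun_prop :
        Continuous fun w : ((ℝ × ℝ) × Set.Icc (0 : ℝ≥0) c) × ℝ => (w.1.1.1, w.2)))
  convert isClosedMap_fst_of_compactSpace C hCc using 1
  ext z
  constructor
  · rintro ⟨t, ht, h1, h2⟩
    exact ⟨(z, ⟨t, zero_le, ht⟩), ⟨h1, h2⟩, rfl⟩
  · rintro ⟨⟨z', t⟩, ⟨h1, h2⟩, rfl⟩
    exact ⟨t, t.2.2, h1, h2⟩

/-- To fire before `c` is to fire by some rational time `a < c` along a trajectory bounded by some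
`n`. This is a countable union of closed sets. -/
theorem measurable_fireTime (H : SHS Q) (q q' : Q) :
    Measurable fun z : ℝ × ℝ => H.fireTime q z.1 q' z.2 := by
  refine measurable_of_Iio fun c => ?_
  have : (fun z : ℝ × ℝ => H.fireTime q z.1 q' z.2) ⁻¹' Set.Iio c
      = ⋃ (n : ℕ) (a : {a : ℚ // (Real.toNNReal a : ℝ≥0∞) < c}),
        {z : ℝ × ℝ | ∃ t : ℝ≥0, t ≤ Real.toNNReal a ∧ StaysWithin (H.f q) n z.1 t ∧
          z.2 ≤ ∫ u in (0 : ℝ)..t, (H.rate q q').eval (truncFlow (H.f q) n z.1 u)} := by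
    ext z
    have heq : ∀ (n : ℕ) (t : ℝ≥0), StaysWithin (H.f q) n z.1 t →
        ∫ u in (0 : ℝ)..t, (H.rate q q').eval (flow (H.f q) z.1 u)
          = ∫ u in (0 : ℝ)..t, (H.rate q q').eval (truncFlow (H.f q) n z.1 u) := by
      intro n t h
      refine intervalIntegral.integral_congr fun u hu => ?_
      rw [Set.uIcc_of_le t.coe_nonneg] at hu
      simp only [h.flow_eq u hu]
    simp only [Set.mem_preimage, Set.mem_Iio, fireTime, iInf_lt_iff, Set.mem_iUnion,
      Set.mem_ofPred_eq]
    constructor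
    · rintro ⟨t, ⟨hs, ht⟩, htc⟩
      obtain ⟨a, -, h1, h2⟩ := ENNReal.lt_iff_exists_rat_btwn.1 htc
      obtain ⟨n, hn⟩ := survives_iff_exists_staysWithin.1 hs
      exact ⟨n, ⟨a, h2⟩, t, ENNReal.coe_le_coe.1 h1.le, hn, heq n t hn ▸ ht⟩
    · rintro ⟨n, ⟨a, ha⟩, t, hta, hn, ht⟩
      exact ⟨t, ⟨hn.survives, (heq n t hn).symm ▸ ht⟩,
        (ENNReal.coe_le_coe.2 hta).trans_lt ha⟩
  rw [this]
  exact MeasurableSet.iUnion fun n => MeasurableSet.iUnion fun a =>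
    (isClosed_exists_le_fire _ _ n _).measurableSet

variable [Fintype Q]

theorem measurable_waitTime (H : SHS Q) (q : Q) :
    Measurable fun z : ℝ × (Q → ℝ) => H.waitTime q z.1 z.2 := by
  refine Measurable.iInf fun q' => ?_
  exact (H.measurable_fireTime q q').comp (by fun_prop :
    Measurable fun z : ℝ × (Q → ℝ) => (z.1, z.2 q'))

-- The choice among minimizers depends on the point only through the set of minimizers, which takes
-- finitely many values.
open Classical in
theorem measurable_target [MeasurableSpace Q] (H : SHS Q) (q : Q) :
    Measurable fun z : ℝ × (Q → ℝ) => H.target q z.1 z.2 := by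
  set A : ℝ × (Q → ℝ) → Q → Prop := fun z r =>
    ∀ l, H.fireTime q z.1 r (z.2 r) ≤ H.fireTime q z.1 l (z.2 l) with hA
  have hAm : Measurable A := by
    refine measurable_pi_lambda _ fun r => ?_
    refine Measurable.forall fun l => ?_
    have h1 : ∀ r, Measurable fun z : ℝ × (Q → ℝ) => H.fireTime q z.1 r (z.2 r) := fun r =>
      (H.measurable_fireTime q r).comp (by fun_prop :
        Measurable fun z : ℝ × (Q → ℝ) => (z.1, z.2 r))
    exact (measurableSet_le (h1 r) (h1 l)).mem
  have hF : (fun z : ℝ × (Q → ℝ) => H.target q z.1 z.2)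
      = (fun B : Q → Prop => if h : ∃ r, B r then h.choose else q) ∘ A := by
    funext z
    have : Nonempty Q := ⟨q⟩
    have h : ∃ r, A z r := Finite.exists_min fun r => H.fireTime q z.1 r (z.2 r)
    simp only [Function.comp, dif_pos h]
    rfl
  rw [hF]
  exact (measurable_of_finite _).comp hAm

/-- The state after the next jump, together with its time, depends measurably on the state and the
clocks. -/
theorem measurable_jumpStep [MeasurableSpace Q] [MeasurableSingletonClass Q] (H : SHS Q) :
    Measurable fun z : (ℝ≥0∞ × Q × ℝ) × (Q → ℝ) =>
      (z.1.1 + H.waitTime z.1.2.1 z.1.2.2 z.2, H.target z.1.2.1 z.1.2.2 z.2,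
        H.γ z.1.2.1 (H.target z.1.2.1 z.1.2.2 z.2) *
          flow (H.f z.1.2.1) z.1.2.2 (H.waitTime z.1.2.1 z.1.2.2 z.2).toReal) := by
  have hw : Measurable fun y : Q × ℝ × (Q → ℝ) => H.waitTime y.1 y.2.1 y.2.2 :=
    measurable_from_prod_countable_right fun q => H.measurable_waitTime q
  have ht : Measurable fun y : Q × ℝ × (Q → ℝ) => H.target y.1 y.2.1 y.2.2 :=
    measurable_from_prod_countable_right fun q => H.measurable_target q
  have hf : Measurable fun y : Q × ℝ × ℝ≥0 => flow (H.f y.1) y.2.1 y.2.2 :=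
    measurable_from_prod_countable_right fun q => measurable_flow (H.f q)
  have hγ : Measurable fun y : Q × Q => H.γ y.1 y.2 := measurable_of_finite _
  have hi : Measurable fun z : (ℝ≥0∞ × Q × ℝ) × (Q → ℝ) => (z.1.2.1, z.1.2.2, z.2) := by fun_prop
  have hw' := hw.comp hi
  have ht' := ht.comp hi
  refine (measurable_fst.fst.add hw').prodMk (ht'.prodMk (Measurable.mul ?_ ?_))
  · exact hγ.comp (measurable_fst.snd.fst.prodMk ht')
  · exact hf.comp (measurable_fst.snd.fst.prodMk
      (measurable_fst.snd.snd.prodMk (ENNReal.measurable_toNNReal.comp hw')))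

end SHS

/-! ### Exponential clocks -/

section Exponential

theorem expMeasure_one_eq :
    expMeasure 1 = volume.withDensity (exponentialPDF 1) := rfl

instance isProbabilityMeasure_expMeasure_one : IsProbabilityMeasure (expMeasure 1) :=
  isProbabilityMeasure_expMeasure one_pos

theorem measurable_exponentialPDF (r : ℝ) : Measurable (exponentialPDF r) :=
  (measurable_exponentialPDFReal r).ennreal_ofReal

theorem expMeasure_one_Ici {a : ℝ} (ha : 0 ≤ a) :
    expMeasure 1 (Set.Ici a) = ENNReal.ofReal (Real.exp (-a)) := by
  rw [expMeasure_one_eq, withDensity_apply _ measurableSet_Ici,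
    setLIntegral_congr_fun (g := fun x => ENNReal.ofReal (Real.exp (-x))) measurableSet_Ici
      (fun x hx => by
        rw [exponentialPDF_of_nonneg (ha.trans hx)]; simp),
    setLIntegral_congr Ioi_ae_eq_Ici.symm,
    ← ofReal_integral_eq_lintegral_ofReal (integrableOn_exp_neg_Ioi a)
      (.of_forall fun x => (Real.exp_pos _).le), integral_exp_neg_Ioi]

theorem ae_expMeasure_one_pos : ∀ᵐ s ∂expMeasure 1, 0 < s := by
  have h1 : expMeasure 1 (Set.Iic 0) = 0 := by
    rw [expMeasure_one_eq, withDensity_apply _ measurableSet_Iic,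
      setLIntegral_congr Iio_ae_eq_Iic.symm, lintegral_exponentialPDF_of_nonpos le_rfl]
  rw [ae_iff]
  simp only [not_lt]
  exact h1

/-- Change of variables for an exponential clock with cumulated rate `A`, where `τ` is the time at
which the clock fires. -/
theorem lintegral_expMeasure_fire {A l τ : ℝ → ℝ} {T : ℝ} (hT : 0 ≤ T)
    (hA : ∀ u ∈ Set.Icc 0 T, HasDerivWithinAt A (l u) (Set.Icc 0 T) u)
    (hl : ∀ u ∈ Set.Icc 0 T, 0 ≤ l u) (hA0 : A 0 = 0)
    (hτ : ∀ u ∈ Set.Icc 0 T, l u ≠ 0 → τ (A u) = u) (h : ℝ → ℝ≥0∞) :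
    ∫⁻ s in Set.Icc 0 (A T), h (τ s) ∂expMeasure 1
      = ∫⁻ u in Set.Icc 0 T, ENNReal.ofReal (l u * Real.exp (-A u)) * h u := by
  have hmono : MonotoneOn A (Set.Icc 0 T) := by
    refine monotoneOn_of_hasDerivWithinAt_nonneg (convex_Icc 0 T)
      (fun u hu => (hA u hu).continuousWithinAt)
      (fun u hu => (hA u (interior_subset hu)).mono interior_subset)
      fun u hu => hl u (interior_subset hu)
  have himage : A '' Set.Icc 0 T = Set.Icc 0 (A T) := by
    refine Set.Subset.antisymm ?_ ?_
    · rintro _ ⟨u, hu, rfl⟩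
      exact ⟨hA0 ▸ hmono ⟨le_rfl, hT⟩ hu hu.1, hmono hu ⟨hT, le_rfl⟩ hu.2⟩
    · have := intermediate_value_Icc hT (fun u hu => (hA u hu).continuousWithinAt)
      rwa [hA0] at this
  have h0 : ∀ u ∈ Set.Icc 0 T, 0 ≤ A u := fun u hu => hA0 ▸ hmono ⟨le_rfl, hT⟩ hu hu.1
  rw [expMeasure_one_eq, restrict_withDensity measurableSet_Icc,
    lintegral_withDensity_eq_lintegral_mul_non_measurable _ (measurable_exponentialPDF 1)
      (.of_forall fun _ => ENNReal.ofReal_lt_top), ← himage,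
    lintegral_image_eq_lintegral_deriv_mul_of_monotoneOn measurableSet_Icc hA hmono]
  refine setLIntegral_congr_fun measurableSet_Icc fun u hu => ?_
  simp only [Pi.mul_apply]
  rw [exponentialPDF_of_nonneg (h0 u hu), ← mul_assoc, ← ENNReal.ofReal_mul (hl u hu)]
  -- On flat pieces of `A` the firing time is not `u`, but there the density vanishes.
  by_cases h1 : l u = 0
  · simp [h1]
  · rw [hτ u hu h1]
    simp

theorem measurable_update_prod {Q : Type*} [DecidableEq Q] (r : Q) :
    Measurable fun z : ℝ × (Q → ℝ) => Function.update z.2 r z.1 := by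
  refine measurable_pi_lambda _ fun i => ?_
  by_cases hi : i = r
  · subst hi; simpa using measurable_fst
  · simp only [Function.update_of_ne hi]
    fun_prop

/-- In a product of probability measures one coordinate can be resampled. -/
theorem pi_eq_map_update {Q : Type*} [Fintype Q] [DecidableEq Q] (μ : Measure ℝ)
    [IsProbabilityMeasure μ] (r : Q) :
    Measure.pi (fun _ : Q => μ)
      = (μ.prod (Measure.pi fun _ : Q => μ)).map fun z => Function.update z.2 r z.1 := by
  have hm := measurable_update_prod r
  refine Measure.pi_eq fun S hS => ?_
  have hpre : (fun z : ℝ × (Q → ℝ) => Function.update z.2 r z.1) ⁻¹' Set.univ.pi S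
      = S r ×ˢ Set.univ.pi (Function.update S r Set.univ) := by
    ext z
    simp only [Set.mem_preimage, Set.mem_pi, Set.mem_univ, true_implies, Set.mem_prod]
    constructor
    · intro h
      refine ⟨by simpa using h r, fun i => ?_⟩
      by_cases hi : i = r
      · subst hi; simp
      · simpa [Function.update_of_ne hi] using h i
    · rintro ⟨h1, h2⟩ i
      by_cases hi : i = r
      · subst hi; simpa using h1
      · simpa [Function.update_of_ne hi] using h2 i
  rw [Measure.map_apply hm (MeasurableSet.univ_pi hS), hpre, Measure.prod_prod, Measure.pi_pi,
    ← Finset.mul_prod_erase _ _ (Finset.mem_univ r),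
    ← Finset.mul_prod_erase _ (fun i => μ (S i)) (Finset.mem_univ r)]
  simp only [Function.update_self, measure_univ, one_mul]
  congr 1
  refine Finset.prod_congr rfl fun i hi => ?_
  rw [Function.update_of_ne (Finset.ne_of_mem_erase hi)]

-- Resampling coordinate `r` and Fubini: given its value `x`, the remaining coordinates are
-- independent and exceed their thresholds `b i x` with product probability.
open Classical in
theorem lintegral_pi_ite_forall_le {Q : Type*} [Fintype Q] (μ : Measure ℝ)
    [IsProbabilityMeasure μ] (r : Q) {F : ℝ → ℝ≥0∞} (hF : Measurable F) {b : Q → ℝ → ℝ}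
    (hb : ∀ i, Measurable (b i)) :
    ∫⁻ s, (if ∀ i, i ≠ r → b i (s r) ≤ s i then F (s r) else 0) ∂Measure.pi (fun _ : Q => μ)
      = ∫⁻ x, (∏ i ∈ Finset.univ.erase r, μ (Set.Ici (b i x))) * F x ∂μ := by
  have hset : MeasurableSet {s : Q → ℝ | ∀ i, i ≠ r → b i (s r) ≤ s i} := by
    simp only [Set.ofPred_forall]
    exact MeasurableSet.iInter fun i => MeasurableSet.iInter fun _ =>
      measurableSet_le ((hb i).comp (measurable_pi_apply r)) (measurable_pi_apply i)
  have hmeas : Measurable fun s : Q → ℝ =>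
      if ∀ i, i ≠ r → b i (s r) ≤ s i then F (s r) else 0 :=
    Measurable.ite hset (hF.comp (measurable_pi_apply r)) measurable_const
  have hm := measurable_update_prod r
  conv_lhs => rw [pi_eq_map_update μ r]
  rw [lintegral_map hmeas hm]
  refine (lintegral_prod _ (hmeas.comp hm).aemeasurable).trans ?_
  refine lintegral_congr fun x => ?_
  have h1 : ∀ s : Q → ℝ, (if ∀ i, i ≠ r → b i (Function.update s r x r) ≤ Function.update s r x i
        then F (Function.update s r x r) else 0)
      = (Set.univ.pi fun i => if i = r then Set.univ else Set.Ici (b i x)).indicator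
          (fun _ => F x) s := by
    intro s
    have h2 : (∀ i, i ≠ r → b i (Function.update s r x r) ≤ Function.update s r x i)
        ↔ s ∈ Set.univ.pi fun i => if i = r then Set.univ else Set.Ici (b i x) := by
      simp only [Set.mem_pi, Set.mem_univ, true_implies, Function.update_self]
      refine forall_congr' fun i => ?_
      by_cases hi : i = r
      · simp [hi]
      · simp [hi]
    rw [Set.indicator_apply, Function.update_self]
    exact if_congr (by simpa only [Function.update_self] using h2) rfl rfl
  refine (lintegral_congr h1).trans ?_
  rw [lintegral_indicator_const (MeasurableSet.univ_pi fun i => by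
    split_ifs
    · exact MeasurableSet.univ
    · exact measurableSet_Ici), Measure.pi_pi, mul_comm,
    ← Finset.mul_prod_erase _ _ (Finset.mem_univ r)]
  simp only [if_true, measure_univ, one_mul]
  congr 1
  refine Finset.prod_congr rfl fun i hi => ?_
  rw [if_neg (Finset.ne_of_mem_erase hi)]

end Exponential

/-! ### The law of the first jump -/

namespace SHS

variable {Q : Type*}

/-- The cumulated rate of the transition to `r` along the truncated trajectory of `(q, x)`. -/
noncomputable def truncCum (H : SHS Q) (q : Q) (n : ℕ) (x : ℝ) (r : Q) (u : ℝ) : ℝ :=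
  ∫ v in (0 : ℝ)..u, (H.rate q r).eval (truncFlow (H.f q) n x v)

theorem hasDerivAt_truncCum (H : SHS Q) (q : Q) (n : ℕ) (x : ℝ) (r : Q) (u : ℝ) :
    HasDerivAt (H.truncCum q n x r) ((H.rate q r).eval (truncFlow (H.f q) n x u)) u :=
  (((H.rate q r).continuous.comp (continuous_truncFlow_right (H.f q) n x)).integral_hasStrictDerivAt
    0 u).hasDerivAt

theorem continuous_truncCum (H : SHS Q) (q : Q) (n : ℕ) (x : ℝ) (r : Q) :
    Continuous (H.truncCum q n x r) :=
  continuous_iff_continuousAt.2 fun u => (H.hasDerivAt_truncCum q n x r u).continuousAt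

theorem truncCum_zero (H : SHS Q) (q : Q) (n : ℕ) (x : ℝ) (r : Q) :
    H.truncCum q n x r 0 = 0 := by simp [truncCum]

theorem rate_truncFlow_nonneg (H : SHS Q) (q : Q) (n : ℕ) {x : ℝ} (hx : 0 ≤ x) (r : Q) {u : ℝ}
    (hu : 0 ≤ u) : 0 ≤ (H.rate q r).eval (truncFlow (H.f q) n x u) :=
  H.rate_nonneg q r _ (truncFlow_nonneg (H.f_zero_nonneg q) n hx hu)

theorem monotoneOn_truncCum (H : SHS Q) (q : Q) (n : ℕ) {x : ℝ} (hx : 0 ≤ x) (r : Q) :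
    MonotoneOn (H.truncCum q n x r) (Set.Ici 0) :=
  monotoneOn_of_hasDerivWithinAt_nonneg (convex_Ici 0)
    (H.continuous_truncCum q n x r).continuousOn
    (fun u _ => (H.hasDerivAt_truncCum q n x r u).hasDerivWithinAt)
    fun _ hu => H.rate_truncFlow_nonneg q n hx r (interior_subset hu)

theorem truncCum_nonneg (H : SHS Q) (q : Q) (n : ℕ) {x : ℝ} (hx : 0 ≤ x) (r : Q) {u : ℝ}
    (hu : 0 ≤ u) : 0 ≤ H.truncCum q n x r u := by
  have := H.monotoneOn_truncCum q n hx r (Set.mem_Ici.2 le_rfl) (Set.mem_Ici.2 hu) hu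
  rwa [truncCum_zero] at this

theorem integral_rate_flow_eq (H : SHS Q) {q : Q} {n : ℕ} {x T : ℝ}
    (h : StaysWithin (H.f q) n x T) (r : Q) {u : ℝ} (hu : u ∈ Set.Icc 0 T) :
    ∫ v in (0 : ℝ)..u, (H.rate q r).eval (flow (H.f q) x v) = H.truncCum q n x r u := by
  refine intervalIntegral.integral_congr fun v hv => ?_
  rw [Set.uIcc_of_le hu.1] at hv
  simp only [h.flow_eq v ⟨hv.1, hv.2.trans hu.2⟩]

open Filter Topology in
/-- A transition fires before time `u` exactly if the cumulated rate at time `u` has reached its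
clock. -/
theorem fireTime_le_iff (H : SHS Q) {q : Q} {n : ℕ} {x : ℝ} (hx : 0 ≤ x) {T : ℝ}
    (h : StaysWithin (H.f q) n x T) (r : Q) (s : ℝ) {u : ℝ≥0} (hu : (u : ℝ) ≤ T) :
    H.fireTime q x r s ≤ u ↔ s ≤ H.truncCum q n x r u := by
  have hu' : (u : ℝ) ∈ Set.Icc 0 T := ⟨u.coe_nonneg, hu⟩
  refine ⟨fun hle => ?_, fun hle => ?_⟩
  · by_contra! hlt
    -- The infimum could be approached from times beyond `u`. The trajectory outlives `u`, and the
    -- cumulated rate stays below `s` up to some `v > u`, which rules this out.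
    obtain ⟨w, huw, hw⟩ := (h.survives.mono hu).exists_gt u.coe_nonneg
    obtain ⟨k, hk⟩ := survives_iff_exists_staysWithin.1 hw
    rw [← H.integral_rate_flow_eq h r hu',
      H.integral_rate_flow_eq hk r ⟨u.coe_nonneg, huw.le⟩] at hlt
    have hev : ∀ᶠ v in 𝓝[>] (u : ℝ), H.truncCum q k x r v < s :=
      (((H.continuous_truncCum q k x r).tendsto u).mono_left
        nhdsWithin_le_nhds).eventually_lt_const hlt
    obtain ⟨v, hv, huv, hvw⟩ := (hev.and (Ioo_mem_nhdsGT huw)).exists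
    have hv0 : 0 ≤ v := u.coe_nonneg.trans huv.le
    have hge : ENNReal.ofReal v ≤ H.fireTime q x r s := by
      refine le_iInf₂ fun t ht => ?_
      rw [ENNReal.ofReal_le_iff_le_toReal ENNReal.coe_ne_top, ENNReal.coe_toReal]
      by_contra! htv
      have h1 := ht.2
      rw [H.integral_rate_flow_eq hk r ⟨t.coe_nonneg, (htv.trans hvw).le⟩] at h1
      have h2 := H.monotoneOn_truncCum q k hx r (Set.mem_Ici.2 t.coe_nonneg)
        (Set.mem_Ici.2 hv0) htv.le
      linarith
    have h3 : ENNReal.ofReal v ≤ ENNReal.ofReal (u : ℝ) := by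
      rw [ENNReal.ofReal_coe_nnreal]; exact hge.trans hle
    rw [ENNReal.ofReal_le_ofReal_iff u.coe_nonneg] at h3
    linarith
  · exact iInf₂_le u ⟨h.survives.mono hu, by rwa [H.integral_rate_flow_eq h r hu']⟩

section FirstJump

variable [Fintype Q]

theorem fireTime_target_le (H : SHS Q) (q : Q) (x : ℝ) (s : Q → ℝ) (l : Q) :
    H.fireTime q x (H.target q x s) (s (H.target q x s)) ≤ H.fireTime q x l (s l) :=
  haveI : Nonempty Q := ⟨q⟩
  (Finite.exists_min fun q' => H.fireTime q x q' (s q')).choose_spec l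

theorem waitTime_eq (H : SHS Q) (q : Q) (x : ℝ) (s : Q → ℝ) :
    H.waitTime q x s = H.fireTime q x (H.target q x s) (s (H.target q x s)) :=
  le_antisymm (iInf_le _ _) (le_iInf fun l => H.fireTime_target_le q x s l)

open Classical in
/-- The law of the time and the target of the first jump. -/
theorem lintegral_firstJump_le (H : SHS Q) {q : Q} {n : ℕ} {x : ℝ} (hx : 0 ≤ x) {T : ℝ≥0}
    (h : StaysWithin (H.f q) n x T) {g : Q → ℝ → ℝ≥0∞} (hg : ∀ r, Measurable (g r)) (a : ℝ≥0∞) :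
    ∫⁻ s, (if H.waitTime q x s ≤ T then g (H.target q x s) (H.waitTime q x s).toReal else a)
        ∂Measure.pi (fun _ : Q => expMeasure 1)
      ≤ ENNReal.ofReal (Real.exp (-∑ r, H.truncCum q n x r T)) * a
        + ∑ r, ∫⁻ u in Set.Icc 0 (T : ℝ),
            ENNReal.ofReal ((H.rate q r).eval (truncFlow (H.f q) n x u)
              * Real.exp (-∑ i, H.truncCum q n x i u)) * g r u := by
  set A := H.truncCum q n x with hA
  set τ : Q → ℝ → ℝ := fun r s => (H.fireTime q x r s).toReal with hτ
  have hτm : ∀ r, Measurable (τ r) := fun r => ((H.measurable_fireTime q r).comp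
    (by fun_prop : Measurable fun s : ℝ => (x, s))).ennreal_toReal
  have hAm : ∀ r, Measurable (A r) := fun r => (H.continuous_truncCum q n x r).measurable
  set box : Set (Q → ℝ) := Set.univ.pi fun r => Set.Ici (A r T) with hbox
  have hboxm : MeasurableSet box := MeasurableSet.univ_pi fun r => measurableSet_Ici
  set F : Q → ℝ → ℝ≥0∞ := fun r =>
    (Set.Icc 0 (A r T)).indicator fun σ => g r (τ r σ) with hF
  have hFm : ∀ r, Measurable (F r) := fun r =>
    ((hg r).comp (hτm r)).indicator measurableSet_Icc
  have hpos : ∀ᵐ s ∂Measure.pi (fun _ : Q => expMeasure 1), ∀ r, 0 < s r := by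
    rw [ae_all_iff]
    exact fun r => Measure.tendsto_eval_ae_ae.eventually ae_expMeasure_one_pos
  -- An upper bound suffices, so ties between clocks need no discussion: the events on the right may
  -- overlap.
  have hbound : ∀ᵐ s ∂Measure.pi (fun _ : Q => expMeasure 1),
      (if H.waitTime q x s ≤ T then g (H.target q x s) (H.waitTime q x s).toReal else a)
        ≤ box.indicator (fun _ => a) s
          + ∑ r, if ∀ i, i ≠ r → A i (τ r (s r)) ≤ s i then F r (s r) else 0 := by
    filter_upwards [hpos] with s hs
    split_ifs with hw
    · set r := H.target q x s with hr
      rw [waitTime_eq, ← hr] at hw ⊢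
      have hle := (H.fireTime_le_iff hx h r (s r) le_rfl).1 hw
      have hmem : s r ∈ Set.Icc 0 (A r T) := ⟨(hs r).le, hle⟩
      have hfin : H.fireTime q x r (s r) ≠ ⊤ := ne_top_of_le_ne_top ENNReal.coe_ne_top hw
      obtain ⟨u, hu⟩ : ∃ u : ℝ≥0, (u : ℝ≥0∞) = H.fireTime q x r (s r) :=
        ⟨_, ENNReal.coe_toNNReal hfin⟩
      have huT : u ≤ T := by rw [← hu] at hw; exact_mod_cast hw
      have hτu : τ r (s r) = u := by simp [hτ, ← hu]
      -- A clock `i` below `A i u` would have fired strictly before `u`, against the minimality of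
      -- `r`.
      have hothers : ∀ i, i ≠ r → A i (τ r (s r)) ≤ s i := by
        intro i _
        rw [hτu]
        by_contra! hlt
        have h1 : s i ∈ A i '' Set.Icc 0 (u : ℝ) :=
          intermediate_value_Icc u.coe_nonneg (H.continuous_truncCum q n x i).continuousOn
            ⟨by rw [H.truncCum_zero]; exact (hs i).le, hlt.le⟩
        obtain ⟨v, hv, hvs⟩ := h1
        have hvu : v < u := lt_of_le_of_ne hv.2 fun h0 => by
          rw [← hvs, h0] at hlt; exact lt_irrefl _ hlt
        lift v to ℝ≥0 using hv.1
        have h2 : H.fireTime q x i (s i) ≤ v :=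
          (H.fireTime_le_iff hx h i (s i)
            (hv.2.trans (NNReal.coe_le_coe.2 huT))).2 hvs.ge
        have h3 := (H.fireTime_target_le q x s i).trans h2
        rw [← hr, ← hu, ENNReal.coe_le_coe] at h3
        exact absurd (NNReal.coe_le_coe.2 h3) (not_le.2 hvu)
      refine le_trans ?_ (le_trans (Finset.single_le_sum
        (f := fun r => if ∀ i, i ≠ r → A i (τ r (s r)) ≤ s i then F r (s r) else 0)
        (fun _ _ => zero_le) (Finset.mem_univ r)) le_add_self)
      simp only [if_pos hothers, hF, Set.indicator_of_mem hmem]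
      exact le_rfl
    · have hmem : s ∈ box := by
        intro r _
        by_contra hlt
        rw [Set.mem_Ici, not_le] at hlt
        exact hw ((iInf_le _ r).trans ((H.fireTime_le_iff hx h r (s r) le_rfl).2 hlt.le))
      rw [Set.indicator_of_mem hmem]
      exact le_self_add
  refine (lintegral_mono_ae hbound).trans ?_
  rw [lintegral_add_left (measurable_const.indicator hboxm)]
  refine add_le_add (le_of_eq ?_) ?_
  · rw [lintegral_indicator_const hboxm, hbox, Measure.pi_pi, mul_comm]
    simp only [expMeasure_one_Ici (H.truncCum_nonneg q n hx _ T.coe_nonneg), hA]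
    rw [← ENNReal.ofReal_prod_of_nonneg fun _ _ => (Real.exp_pos _).le, ← Real.exp_sum,
      Finset.sum_neg_distrib]
  · have hterm : ∀ r, Measurable fun s : Q → ℝ =>
        if ∀ i, i ≠ r → A i (τ r (s r)) ≤ s i then F r (s r) else 0 := by
      intro r
      refine Measurable.ite ?_ ((hFm r).comp (measurable_pi_apply r)) measurable_const
      simp only [Set.ofPred_forall]
      exact MeasurableSet.iInter fun i => MeasurableSet.iInter fun _ => measurableSet_le
        ((hAm i).comp ((hτm r).comp (measurable_pi_apply r))) (measurable_pi_apply i)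
    rw [lintegral_finsetSum _ fun r _ => hterm r]
    refine Finset.sum_le_sum fun r _ => le_of_eq ?_
    rw [lintegral_pi_ite_forall_le (expMeasure 1) r (hFm r) (b := fun i σ => A i (τ r σ))
      fun i => (hAm i).comp (hτm r)]
    have h1 : ∀ σ, (∏ i ∈ Finset.univ.erase r, expMeasure 1 (Set.Ici (A i (τ r σ)))) * F r σ
        = (Set.Icc 0 (A r T)).indicator (fun σ =>
          (∏ i ∈ Finset.univ.erase r, expMeasure 1 (Set.Ici (A i (τ r σ)))) * g r (τ r σ)) σ := by
      intro σ
      by_cases hσ : σ ∈ Set.Icc 0 (A r T) <;> simp [hF, hσ]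
    rw [lintegral_congr h1, lintegral_indicator measurableSet_Icc]
    -- If the clock `A r u` fired at some `w < u`, then `A r` would be constant on `[w, u]` and the
    -- rate at `u` would be zero.
    have hfire : ∀ u ∈ Set.Icc 0 (T : ℝ), (H.rate q r).eval (truncFlow (H.f q) n x u) ≠ 0 →
        τ r (A r u) = u := by
      intro u hu hne
      lift u to ℝ≥0 using hu.1
      have h2 : H.fireTime q x r (A r u) ≤ u :=
        (H.fireTime_le_iff hx h r _ hu.2).2 le_rfl
      obtain ⟨w, hw⟩ : ∃ w : ℝ≥0, (w : ℝ≥0∞) = H.fireTime q x r (A r u) :=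
        ⟨_, ENNReal.coe_toNNReal (ne_top_of_le_ne_top ENNReal.coe_ne_top h2)⟩
      rw [← hw, ENNReal.coe_le_coe] at h2
      have hwu : (w : ℝ) ≤ u := NNReal.coe_le_coe.2 h2
      have hτw : τ r (A r u) = w := by simp [hτ, ← hw]
      rw [hτw]
      by_contra hwne
      have hlt : (w : ℝ) < u := lt_of_le_of_ne hwu hwne
      have h3 : A r u ≤ A r w := (H.fireTime_le_iff hx h r _ (hwu.trans hu.2)).1 hw.ge
      have hconst : ∀ v ∈ Set.Icc (w : ℝ) u, A r v = A r u := fun v hv =>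
        le_antisymm (H.monotoneOn_truncCum q n hx r (Set.mem_Ici.2 (w.coe_nonneg.trans hv.1))
          (Set.mem_Ici.2 hu.1) hv.2) (h3.trans (H.monotoneOn_truncCum q n hx r
          (Set.mem_Ici.2 w.coe_nonneg) (Set.mem_Ici.2 (w.coe_nonneg.trans hv.1)) hv.1))
      have h4 : HasDerivWithinAt (A r) 0 (Set.Icc (w : ℝ) u) u :=
        (hasDerivWithinAt_const (u : ℝ) _ (A r u)).congr hconst rfl
      have h5 : UniqueDiffWithinAt ℝ (Set.Icc (w : ℝ) u) (u : ℝ) :=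
        uniqueDiffOn_Icc hlt _ ⟨hlt.le, le_rfl⟩
      exact hne (h5.eq_deriv _
        (H.hasDerivAt_truncCum q n x r u).hasDerivWithinAt h4)
    rw [lintegral_expMeasure_fire (τ := τ r) T.coe_nonneg
      (fun u _ => (H.hasDerivAt_truncCum q n x r u).hasDerivWithinAt)
      (fun u hu => H.rate_truncFlow_nonneg q n hx r hu.1) (H.truncCum_zero q n x r) hfire
      fun u => (∏ i ∈ Finset.univ.erase r, expMeasure 1 (Set.Ici (A i u))) * g r u]
    refine setLIntegral_congr_fun measurableSet_Icc fun u hu => ?_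
    have h5 : ∏ i ∈ Finset.univ.erase r, expMeasure 1 (Set.Ici (A i u))
        = ENNReal.ofReal (Real.exp (-∑ i ∈ Finset.univ.erase r, A i u)) := by
      rw [Finset.prod_congr rfl fun i _ =>
          expMeasure_one_Ici (H.truncCum_nonneg q n hx i hu.1),
        ← ENNReal.ofReal_prod_of_nonneg fun _ _ => (Real.exp_pos _).le, ← Real.exp_sum,
        Finset.sum_neg_distrib]
    rw [h5, ← mul_assoc, ← ENNReal.ofReal_mul (mul_nonneg
      (H.rate_truncFlow_nonneg q n hx r hu.1) (Real.exp_pos _).le), mul_assoc, ← Real.exp_add,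
      ← neg_add, Finset.add_sum_erase _ (fun i => A i u) (Finset.mem_univ r)]

end FirstJump

end SHS

/-! ### The Lyapunov bound up to the first jump -/

namespace SHS

variable {Q : Type*}

/-- The bound for `E[v Q_t * X_t ^ m]` of the process that starts in `(q, x)`. -/
noncomputable def lyapBound (v : Q → ℝ) (ε K : ℝ) (m : ℕ) (t : ℝ) (q : Q) (x : ℝ) : ℝ :=
  Real.exp (-(ε * t)) * (v q * x ^ m) + K * (1 - Real.exp (-(ε * t)))

section LyapBound

variable {v : Q → ℝ} {ε K : ℝ} {m : ℕ}

theorem lyapBound_zero (q : Q) (x : ℝ) : lyapBound v ε K m 0 q x = v q * x ^ m := by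
  simp [lyapBound]

theorem le_lyapBound (hε : 0 ≤ ε) (hK : 0 ≤ K) {t : ℝ} (ht : 0 ≤ t) (q : Q)
    (x : ℝ) : Real.exp (-(ε * t)) * (v q * x ^ m) ≤ lyapBound v ε K m t q x := by
  have : Real.exp (-(ε * t)) ≤ 1 := Real.exp_le_one_iff.2 (by have := mul_nonneg hε ht; linarith)
  have := mul_nonneg hK (sub_nonneg.2 this)
  simp only [lyapBound]
  linarith

theorem lyapBound_nonneg (hv : ∀ q, 0 ≤ v q) (hε : 0 ≤ ε) (hK : 0 ≤ K) {t : ℝ} (ht : 0 ≤ t)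
    (q : Q) {x : ℝ} (hx : 0 ≤ x) : 0 ≤ lyapBound v ε K m t q x :=
  (mul_nonneg (Real.exp_pos _).le (mul_nonneg (hv q) (pow_nonneg hx m))).trans
    (le_lyapBound hε hK ht q x)

theorem lyapBound_le (hv : ∀ q, 0 ≤ v q) (hε : 0 ≤ ε) (hK : 0 ≤ K) {t : ℝ} (ht : 0 ≤ t)
    (q : Q) {x : ℝ} (hx : 0 ≤ x) : lyapBound v ε K m t q x ≤ v q * x ^ m + K := by
  have h1 : Real.exp (-(ε * t)) ≤ 1 :=
    Real.exp_le_one_iff.2 (by have := mul_nonneg hε ht; linarith)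
  have h2 := mul_le_mul_of_nonneg_right h1 (mul_nonneg (hv q) (pow_nonneg hx m))
  have h3 := mul_nonneg hK (Real.exp_pos (-(ε * t))).le
  simp only [lyapBound]
  linarith

theorem continuous_lyapBound (q : Q) :
    Continuous fun z : ℝ × ℝ => lyapBound v ε K m z.1 q z.2 := by
  unfold lyapBound; fun_prop

variable [Fintype Q]

/-- The drift condition, integrated along a trajectory up to the first jump. -/
theorem drift_integral_le {H : SHS Q} (hε : 0 ≤ ε)
    (hdrift : ∀ q x, 0 ≤ x → (H.genPoly v m q).eval x
      ≤ K * ε - ε * (v q * x ^ m) - ∑ l, (H.rate q l).eval x)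
    {q : Q} {n : ℕ} {x T t : ℝ} (hx : 0 ≤ x) (hT : 0 ≤ T)
    (h : StaysWithin (H.f q) n x T) :
    Real.exp (-∑ r, H.truncCum q n x r T)
        * lyapBound v ε K m (t - T) q (truncFlow (H.f q) n x T)
      + ∫ u in (0 : ℝ)..T, ∑ r, (H.rate q r).eval (truncFlow (H.f q) n x u)
          * Real.exp (-∑ i, H.truncCum q n x i u) * (Real.exp (-(ε * t))
            + lyapBound v ε K m (t - u) r (H.γ q r * truncFlow (H.f q) n x u))
      ≤ lyapBound v ε K m t q x := by
  set y := truncFlow (H.f q) n x with hy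
  have hyc : Continuous y := continuous_truncFlow_right (H.f q) n x
  set A := H.truncCum q n x with hA
  have hAc : ∀ r, Continuous (A r) := H.continuous_truncCum q n x
  set g : ℝ → ℝ := fun u => ∑ r, (H.rate q r).eval (y u) * Real.exp (-∑ i, A i u)
    * (Real.exp (-(ε * t)) + lyapBound v ε K m (t - u) r (H.γ q r * y u)) with hg
  have hgc : Continuous g := by
    refine continuous_finsetSum _ fun r _ => ?_
    have h1 : Continuous fun u => lyapBound v ε K m (t - u) r (H.γ q r * y u) :=
      (continuous_lyapBound r).comp (by fun_prop :
        Continuous fun u => (t - u, H.γ q r * y u))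
    have h2 : Continuous fun u => (H.rate q r).eval (y u) := (H.rate q r).continuous.comp hyc
    fun_prop
  -- `N u` is the expectation of the bound at the first jump or at time `u`, whichever comes first,
  -- plus the reward if the jump comes first.
  set N : ℝ → ℝ := fun u => Real.exp (-∑ r, A r u) * lyapBound v ε K m (t - u) q (y u)
    + ∫ w in (0 : ℝ)..u, g w with hN
  have hNc : Continuous N := by
    have h1 : Continuous fun u => lyapBound v ε K m (t - u) q (y u) :=
      (continuous_lyapBound q).comp (by fun_prop : Continuous fun u => (t - u, y u))
    have h2 : Continuous fun u => ∫ w in (0 : ℝ)..u, g w :=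
      intervalIntegral.continuous_primitive (fun a b => hgc.intervalIntegrable a b) 0
    fun_prop
  have hNd : ∀ u ∈ Set.Ioo 0 T, HasDerivAt N
      ((Real.exp (-∑ r, A r u) * -∑ r, (H.rate q r).eval (y u))
          * lyapBound v ε K m (t - u) q (y u)
        + Real.exp (-∑ r, A r u) * ((Real.exp (-(ε * (t - u))) * -(ε * -1) * (v q * y u ^ m)
            + Real.exp (-(ε * (t - u)))
              * (v q * (m * y u ^ (m - 1) * (H.f q).eval (y u))))
          + K * -(Real.exp (-(ε * (t - u))) * -(ε * -1))) + g u) u := by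
    intro u hu
    have hyd : HasDerivAt y ((H.f q).eval (y u)) u :=
      (h.isSolutionOn.2 u ⟨hu.1.le, hu.2.le⟩).hasDerivAt (Icc_mem_nhds hu.1 hu.2)
    have hE : HasDerivAt (fun u => Real.exp (-(ε * (t - u))))
        (Real.exp (-(ε * (t - u))) * -(ε * -1)) u :=
      (((hasDerivAt_id u).const_sub t).const_mul ε).neg.exp
    have hS : HasDerivAt (fun u => ∑ r, A r u) (∑ r, (H.rate q r).eval (y u)) u :=
      HasDerivAt.fun_sum fun r _ => H.hasDerivAt_truncCum q n x r u
    have hG : HasDerivAt (fun u => lyapBound v ε K m (t - u) q (y u))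
        ((Real.exp (-(ε * (t - u))) * -(ε * -1) * (v q * y u ^ m)
            + Real.exp (-(ε * (t - u)))
              * (v q * (m * y u ^ (m - 1) * (H.f q).eval (y u))))
          + K * -(Real.exp (-(ε * (t - u))) * -(ε * -1))) u :=
      (hE.mul ((hyd.pow m).const_mul (v q))).add ((hE.const_sub 1).const_mul K)
    exact (hS.neg.exp.mul hG).add (hgc.integral_hasStrictDerivAt 0 u).hasDerivAt
  have hanti : AntitoneOn N (Set.Icc 0 T) := by
    refine antitoneOn_of_hasDerivWithinAt_nonpos (convex_Icc 0 T) hNc.continuousOn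
      (fun u hu => (hNd u (by rwa [interior_Icc] at hu)).hasDerivWithinAt) fun u hu => ?_
    rw [interior_Icc] at hu
    have hy0 : 0 ≤ y u := truncFlow_nonneg (H.f_zero_nonneg q) n hx hu.1.le
    have hd := hdrift q (y u) hy0
    rw [eval_genPoly] at hd
    set E := Real.exp (-(ε * (t - u))) with hE
    set Λ := ∑ r, (H.rate q r).eval (y u) with hΛ
    have hΛ0 : 0 ≤ Λ := Finset.sum_nonneg fun r _ => H.rate_nonneg q r _ hy0
    have hcE : Real.exp (-(ε * t)) ≤ E := by
      rw [hE, Real.exp_le_exp]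
      have := mul_nonneg hε hu.1.le
      linarith
    have hgu : g u = Real.exp (-∑ r, A r u) * (Λ * Real.exp (-(ε * t))
        + E * (∑ r, (H.γ q r ^ m * v r - v q) * y u ^ m * (H.rate q r).eval (y u))
        + Λ * (E * (v q * y u ^ m) + K * (1 - E))) := by
      simp only [hg, hΛ, lyapBound, ← hE, Finset.mul_sum, Finset.sum_mul,
        ← Finset.sum_add_distrib]
      refine Finset.sum_congr rfl fun r _ => ?_
      rw [mul_pow]
      ring
    have hP := Real.exp_pos (-∑ r, A r u)
    have hE0 : 0 < E := Real.exp_pos _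
    rw [hgu]
    simp only [lyapBound, ← hE]
    set P := Real.exp (-∑ r, A r u)
    set S := ∑ r, (H.γ q r ^ m * v r - v q) * y u ^ m * (H.rate q r).eval (y u)
    -- The loss `Λ * lyapBound` from the survival factor cancels against the gain in `g`. What
    -- remains is `E` times the drift inequality, whose slack `-E Λ` pays for the reward `Λ exp (-ε
    -- t)`.
    have h1 := mul_le_mul_of_nonneg_left hd hE0.le
    have h2 := mul_le_mul_of_nonneg_left hcE hΛ0
    have h3 : P * (E * (v q * m * y u ^ (m - 1) * (H.f q).eval (y u) + S)
        - E * (K * ε - ε * (v q * y u ^ m) - Λ) + (Λ * Real.exp (-(ε * t)) - Λ * E)) ≤ 0 :=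
      mul_nonpos_of_nonneg_of_nonpos hP.le (by linarith)
    linarith
  have hle := hanti ⟨le_rfl, hT⟩ ⟨hT, le_rfl⟩ hT
  have hN0 : N 0 = lyapBound v ε K m t q x := by
    simp [hN, hA, H.truncCum_zero, hy, truncFlow_zero]
  rw [hN0] at hle
  exact hle

open Classical in
/-- The one-step inequality up to a time at which the trajectory still exists. -/
theorem lintegral_step_le_of_survives {H : SHS Q} (hv : ∀ q, 0 ≤ v q) (hε : 0 ≤ ε) (hK : 0 ≤ K)
    (hdrift : ∀ q x, 0 ≤ x → (H.genPoly v m q).eval x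
      ≤ K * ε - ε * (v q * x ^ m) - ∑ l, (H.rate q l).eval x)
    {q : Q} {x t : ℝ} {T : ℝ≥0} (hx : 0 ≤ x) (hTt : T ≤ t) (h : Survives (H.f q) x T) :
    ∫⁻ s, (if H.waitTime q x s ≤ T then
        ENNReal.ofReal (Real.exp (-(ε * t)) + lyapBound v ε K m (t - (H.waitTime q x s).toReal)
          (H.target q x s) (H.γ q (H.target q x s) *
            flow (H.f q) x (H.waitTime q x s).toReal))
        else ENNReal.ofReal (lyapBound v ε K m (t - T) q (flow (H.f q) x T)))
        ∂Measure.pi (fun _ : Q => expMeasure 1)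
      ≤ ENNReal.ofReal (lyapBound v ε K m t q x) := by
  obtain ⟨n, hn⟩ := survives_iff_exists_staysWithin.1 h
  set y := truncFlow (H.f q) n x with hy
  have hyc : Continuous y := continuous_truncFlow_right (H.f q) n x
  have hy0 : ∀ u, 0 ≤ u → 0 ≤ y u := fun u => truncFlow_nonneg (H.f_zero_nonneg q) n hx
  set g : Q → ℝ → ℝ := fun r u =>
    Real.exp (-(ε * t)) + lyapBound v ε K m (t - u) r (H.γ q r * y u) with hg
  have hgc : ∀ r, Continuous (g r) := fun r =>
    continuous_const.add ((continuous_lyapBound r).comp (by fun_prop :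
      Continuous fun u => (t - u, H.γ q r * y u)))
  have hg0 : ∀ r, ∀ u ∈ Set.Icc 0 (T : ℝ), 0 ≤ g r u := fun r u hu =>
    add_nonneg (Real.exp_pos _).le (lyapBound_nonneg hv hε hK (by linarith [hu.2]) r
      (mul_nonneg (H.γ_nonneg q r) (hy0 u hu.1)))
  set k : Q → ℝ → ℝ := fun r u =>
    (H.rate q r).eval (y u) * Real.exp (-∑ i, H.truncCum q n x i u) with hk
  have hkc : ∀ r, Continuous (k r) := by
    intro r
    have h1 : Continuous fun u => (H.rate q r).eval (y u) := (H.rate q r).continuous.comp hyc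
    have h2 := H.continuous_truncCum q n x
    simp only [hk]
    fun_prop
  have hk0 : ∀ r, ∀ u ∈ Set.Icc 0 (T : ℝ), 0 ≤ k r u := fun r u hu =>
    mul_nonneg (H.rate_truncFlow_nonneg q n hx r hu.1) (Real.exp_pos _).le
  have h1 : ∀ s, (if H.waitTime q x s ≤ T then
        ENNReal.ofReal (Real.exp (-(ε * t)) + lyapBound v ε K m (t - (H.waitTime q x s).toReal)
          (H.target q x s) (H.γ q (H.target q x s) *
            flow (H.f q) x (H.waitTime q x s).toReal))
        else ENNReal.ofReal (lyapBound v ε K m (t - T) q (flow (H.f q) x T)))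
      = if H.waitTime q x s ≤ T then
        (fun r u => ENNReal.ofReal (g r u)) (H.target q x s) (H.waitTime q x s).toReal
        else ENNReal.ofReal (lyapBound v ε K m (t - T) q (y T)) := by
    intro s
    split_ifs with hw
    · have hw' : (H.waitTime q x s).toReal ≤ T := ENNReal.toReal_mono ENNReal.coe_ne_top hw
      simp only [hg, hn.flow_eq _ ⟨ENNReal.toReal_nonneg, hw'⟩, hy]
    · rw [hn.flow_eq _ ⟨T.coe_nonneg, le_rfl⟩]
  rw [lintegral_congr h1]
  refine (H.lintegral_firstJump_le hx hn (fun r => (hgc r).measurable.ennreal_ofReal) _).trans ?_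
  have h2 : ∑ r, ∫⁻ u in Set.Icc 0 (T : ℝ), ENNReal.ofReal (k r u) * ENNReal.ofReal (g r u)
      = ENNReal.ofReal (∫ u in (0 : ℝ)..T, ∑ r, k r u * g r u) := by
    rw [← lintegral_finsetSum (f := fun r u => ENNReal.ofReal (k r u) * ENNReal.ofReal (g r u)) _
      fun r _ => (hkc r).measurable.ennreal_ofReal.mul (hgc r).measurable.ennreal_ofReal]
    have h3 : ∀ u ∈ Set.Icc 0 (T : ℝ), ∑ r, ENNReal.ofReal (k r u) * ENNReal.ofReal (g r u)
        = ENNReal.ofReal (∑ r, k r u * g r u) := by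
      intro u hu
      rw [ENNReal.ofReal_sum_of_nonneg fun r _ => mul_nonneg (hk0 r u hu) (hg0 r u hu)]
      exact Finset.sum_congr rfl fun r _ => (ENNReal.ofReal_mul (hk0 r u hu)).symm
    have hc : Continuous fun u => ∑ r, k r u * g r u := by fun_prop
    rw [setLIntegral_congr_fun measurableSet_Icc h3,
      intervalIntegral.integral_of_le T.coe_nonneg, ← integral_Icc_eq_integral_Ioc,
      ofReal_integral_eq_lintegral_ofReal (hc.continuousOn.integrableOn_compact isCompact_Icc)]
    filter_upwards [ae_restrict_mem measurableSet_Icc] with u hu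
    exact Finset.sum_nonneg fun r _ => mul_nonneg (hk0 r u hu) (hg0 r u hu)
  rw [h2, ← ENNReal.ofReal_mul (Real.exp_pos _).le, ← ENNReal.ofReal_add]
  · exact ENNReal.ofReal_le_ofReal (drift_integral_le hε hdrift hx T.coe_nonneg hn)
  · exact mul_nonneg (Real.exp_pos _).le
      (lyapBound_nonneg hv hε hK (by linarith) q (hy0 _ T.coe_nonneg))
  · refine intervalIntegral.integral_nonneg T.coe_nonneg fun u hu => ?_
    exact Finset.sum_nonneg fun r _ => mul_nonneg (hk0 r u hu) (hg0 r u hu)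

end LyapBound

end SHS

/-! ### Blow-up before the first jump -/

namespace SHS

variable {Q : Type*} [Fintype Q]

/-- Firing times are infima over times of survival only, so a jump at a finite time precedes any
blow-up. -/
theorem exists_survives_of_waitTime_ne_top (H : SHS Q) {q : Q} {x : ℝ} {s : Q → ℝ}
    (h : H.waitTime q x s ≠ ⊤) :
    ∃ u : ℝ≥0, Survives (H.f q) x u ∧ H.waitTime q x s ≤ u := by
  have hlt := lt_top_iff_ne_top.2 h
  rw [waitTime_eq, fireTime] at hlt
  simp only [iInf_lt_iff] at hlt
  obtain ⟨u, hu, -⟩ := hlt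
  refine ⟨u, hu.1, ?_⟩
  rw [waitTime_eq]
  exact iInf₂_le u hu

theorem flow_waitTime_nonneg (H : SHS Q) {q : Q} {x : ℝ} (hx : 0 ≤ x) (s : Q → ℝ) :
    0 ≤ flow (H.f q) x (H.waitTime q x s).toReal := by
  by_cases h : H.waitTime q x s = ⊤
  -- An infinite waiting time has `toReal` equal to `0`, where the flow is still at `x`.
  · rw [h, ENNReal.toReal_top, flow_zero]
    exact hx
  · obtain ⟨u, hu, hle⟩ := H.exists_survives_of_waitTime_ne_top h
    exact hu.flow_nonneg (H.f_zero_nonneg q) hx _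
      ⟨ENNReal.toReal_nonneg, ENNReal.toReal_mono ENNReal.coe_ne_top hle⟩

theorem measurable_lyapBound_target [MeasurableSpace Q] [MeasurableSingletonClass Q] (H : SHS Q)
    (v : Q → ℝ) (ε K : ℝ) (m : ℕ) (t : ℝ) (q : Q) (x : ℝ) :
    Measurable fun s : Q → ℝ => lyapBound v ε K m (t - (H.waitTime q x s).toReal)
      (H.target q x s) (H.γ q (H.target q x s) * flow (H.f q) x (H.waitTime q x s).toReal) := by
  have hl : Measurable fun y : Q × ℝ × ℝ => lyapBound v ε K m y.2.1 y.1 y.2.2 :=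
    measurable_from_prod_countable_right fun q => (continuous_lyapBound q).measurable
  have hx : Measurable fun s : Q → ℝ => (x, s) := by fun_prop
  have hw := (H.measurable_waitTime q).comp hx
  have ht := (H.measurable_target q).comp hx
  have hf : Measurable fun s : Q → ℝ => flow (H.f q) x (H.waitTime q x s).toReal :=
    (measurable_flow (H.f q)).comp
      (measurable_const.prodMk (ENNReal.measurable_toNNReal.comp hw))
  have hγ : Measurable fun r : Q => H.γ q r := measurable_of_finite _
  exact hl.comp (ht.prodMk ((measurable_const.sub (ENNReal.measurable_toReal.comp hw)).prodMk
    ((hγ.comp ht).mul hf)))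

open Classical Filter Topology in
/-- The one-step inequality. -/
theorem lintegral_step_le [MeasurableSpace Q] [MeasurableSingletonClass Q] {H : SHS Q}
    {v : Q → ℝ} {ε K : ℝ} {m : ℕ} (hm : 1 ≤ m) (hv : ∀ q, 0 < v q) (hε : 0 ≤ ε) (hK : 0 ≤ K)
    (hdrift : ∀ q x, 0 ≤ x → (H.genPoly v m q).eval x
      ≤ K * ε - ε * (v q * x ^ m) - ∑ l, (H.rate q l).eval x)
    {q : Q} {x : ℝ} {t : ℝ≥0} (hx : 0 ≤ x) :
    ∫⁻ s, (if H.waitTime q x s ≤ t then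
        ENNReal.ofReal (Real.exp (-(ε * t)) + lyapBound v ε K m (t - (H.waitTime q x s).toReal)
          (H.target q x s) (H.γ q (H.target q x s) *
            flow (H.f q) x (H.waitTime q x s).toReal))
        else if Survives (H.f q) x t then ENNReal.ofReal (v q * flow (H.f q) x t ^ m) else ⊤)
        ∂Measure.pi (fun _ : Q => expMeasure 1)
      ≤ ENNReal.ofReal (lyapBound v ε K m t q x) := by
  have hv' : ∀ q, 0 ≤ v q := fun q => (hv q).le
  by_cases hst : Survives (H.f q) x t
  · simpa [hst, lyapBound_zero] using
      lintegral_step_le_of_survives hv' hε hK hdrift hx le_rfl hst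
  · simp only [hst, if_false]
    -- The levels `k + k₀` lie above `x`, so the exploding trajectory attains each of them at a time
    -- `T k ≤ t`. The inequality up to `T k` passes to the limit by Fatou.
    obtain ⟨k₀, hk₀⟩ := exists_nat_gt x
    have hT : ∀ k : ℕ, ∃ T : ℝ≥0, T ≤ t ∧ Survives (H.f q) x T
        ∧ flow (H.f q) x T = (k + k₀ : ℕ) := by
      intro k
      obtain ⟨T, h0, h1, h2, h3⟩ := exists_flow_eq_of_not_survives (H.f_zero_nonneg q) hx hst
        (k := k + k₀) (by push_cast; have : (0 : ℝ) ≤ k := k.cast_nonneg; linarith)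
      lift T to ℝ≥0 using h0
      exact ⟨T, NNReal.coe_le_coe.1 h1, h2, h3⟩
    choose T hTt hTs hTk using hT
    set g : (Q → ℝ) → ℝ≥0∞ := fun s =>
      ENNReal.ofReal (Real.exp (-(ε * t)) + lyapBound v ε K m (t - (H.waitTime q x s).toReal)
          (H.target q x s) (H.γ q (H.target q x s) *
            flow (H.f q) x (H.waitTime q x s).toReal)) with hg
    have hgm : Measurable g :=
      (measurable_const.add (H.measurable_lyapBound_target v ε K m t q x)).ennreal_ofReal
    set F : ℕ → (Q → ℝ) → ℝ≥0∞ := fun k s => if H.waitTime q x s ≤ T k then g s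
      else ENNReal.ofReal (lyapBound v ε K m (t - T k) q (flow (H.f q) x (T k))) with hF
    have hFm : ∀ k, Measurable (F k) := fun k => Measurable.ite
      (((H.measurable_waitTime q).comp (by fun_prop : Measurable fun s : Q → ℝ => (x, s)))
        measurableSet_Iic) hgm measurable_const
    have hFle : ∀ k, ∫⁻ s, F k s ∂Measure.pi (fun _ : Q => expMeasure 1)
        ≤ ENNReal.ofReal (lyapBound v ε K m t q x) := fun k =>
      lintegral_step_le_of_survives hv' hε hK hdrift hx (NNReal.coe_le_coe.2 (hTt k)) (hTs k)
    -- Without a jump the integrand at `T k` is at least `exp (-ε t) * v q * k`, which tends to `∞`.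
    -- If there is a jump, it comes by a time `u` up to which the trajectory is bounded, so `u ≤ T
    -- k` for large `k`.
    have hpt : ∀ s, (if H.waitTime q x s ≤ t then g s else ⊤) ≤ liminf (fun k => F k s) atTop := by
      intro s
      by_cases htop : H.waitTime q x s = ⊤
      · have h1 : Tendsto (fun k => F k s) atTop (𝓝 ⊤) := by
          have h2 : Tendsto (fun k : ℕ => ENNReal.ofReal
              (Real.exp (-(ε * t)) * (v q * (k : ℝ)))) atTop (𝓝 ⊤) :=
            ENNReal.tendsto_ofReal_nhds_top.2 <| (tendsto_natCast_atTop_atTop.const_mul_atTop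
              (hv q)).const_mul_atTop (Real.exp_pos _)
          refine tendsto_nhds_top_mono' h2 fun k => ?_
          simp only [hF, htop, top_le_iff, ENNReal.coe_ne_top, if_false, hTk]
          refine ENNReal.ofReal_le_ofReal (le_trans ?_
            (le_lyapBound hε hK (sub_nonneg.2 (NNReal.coe_le_coe.2 (hTt k))) q _))
          have hk0 : (0 : ℝ) ≤ k := k.cast_nonneg
          have h3 : (k : ℝ) ≤ ((k + k₀ : ℕ) : ℝ) ^ m := by
            by_cases hz : k + k₀ = 0
            · have : k = 0 := by omega
              simp [this]
            · have h4 : k + k₀ ≤ (k + k₀) ^ m := Nat.le_self_pow (by omega) _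
              have h5 : k ≤ (k + k₀) ^ m := by omega
              exact_mod_cast h5
          have h6 : Real.exp (-(ε * t)) ≤ Real.exp (-(ε * (t - T k))) := by
            rw [Real.exp_le_exp]
            have := mul_nonneg hε (T k).coe_nonneg
            linarith
          exact mul_le_mul h6 (mul_le_mul_of_nonneg_left h3 (hv' q))
            (mul_nonneg (hv' q) hk0) (Real.exp_pos _).le
        rw [h1.liminf_eq]
        exact le_top
      · obtain ⟨u, hu, hle⟩ := H.exists_survives_of_waitTime_ne_top htop
        have hut : u ≤ t := by
          by_contra! hlt
          exact hst (hu.mono (NNReal.coe_le_coe.2 hlt.le))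
        rw [if_pos (hle.trans (ENNReal.coe_le_coe.2 hut))]
        obtain ⟨n, hn⟩ := hu.isSolutionOn_flow.exists_abs_le
        refine le_liminf_of_le (by isBoundedDefault) ?_
        filter_upwards [eventually_gt_atTop n] with k hk
        have huT : u ≤ T k := by
          by_contra! hlt
          have h1 := hn (T k) ⟨(T k).coe_nonneg, NNReal.coe_le_coe.2 hlt.le⟩
          rw [hTk, Nat.abs_cast, Nat.cast_le] at h1
          omega
        simp only [hF, if_pos (hle.trans (ENNReal.coe_le_coe.2 huT))]
        exact le_rfl
    calc _ ≤ ∫⁻ s, liminf (fun k => F k s) atTop ∂Measure.pi (fun _ : Q => expMeasure 1) :=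
          lintegral_mono hpt
      _ ≤ liminf (fun k => ∫⁻ s, F k s ∂Measure.pi (fun _ : Q => expMeasure 1)) atTop :=
          lintegral_liminf_le hFm
      _ ≤ _ := (liminf_le_liminf (.of_forall hFle)).trans (by simp)

end SHS

/-! ### Independence of the next clocks from the past -/

/-- If `X` is independent of `W`, and two functions `U`, `V` of `W` are independent, then `(X, U)`
and `V` are independent. -/
theorem ProbabilityTheory.IndepFun.prodMk_of_indepFun {Ω α β γ δ : Type*} [MeasurableSpace Ω]
    [MeasurableSpace α] [MeasurableSpace β] [MeasurableSpace γ] [MeasurableSpace δ]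
    {P : Measure Ω} [IsProbabilityMeasure P] {X : Ω → α} {W : Ω → β} (hX : Measurable X)
    (hW : Measurable W) (hXW : IndepFun X W P) {φ : β → γ} {ψ : β → δ} (hφ : Measurable φ)
    (hψ : Measurable ψ) (h : IndepFun (φ ∘ W) (ψ ∘ W) P) :
    IndepFun (fun ω => (X ω, φ (W ω))) (ψ ∘ W) P := by
  have hU := hφ.comp hW
  have hV := hψ.comp hW
  have h1 : IndepFun X (φ ∘ W) P := hXW.comp measurable_id hφ
  have h2 : IndepFun X (fun ω => ((φ ∘ W) ω, (ψ ∘ W) ω)) P :=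
    hXW.comp measurable_id (hφ.prodMk hψ)
  change IndepFun (fun ω => (X ω, (φ ∘ W) ω)) (ψ ∘ W) P
  rw [indepFun_iff_map_prod_eq_prod_map_map (hX.prodMk hU).aemeasurable hV.aemeasurable]
  have := Measure.isProbabilityMeasure_map (μ := P) hX.aemeasurable
  have := Measure.isProbabilityMeasure_map (μ := P) hU.aemeasurable
  have := Measure.isProbabilityMeasure_map (μ := P) hV.aemeasurable
  have h3 := h1.map_prod_eq_prod_map_map hX.aemeasurable hU.aemeasurable
  have h4 := h2.map_prod_eq_prod_map_map hX.aemeasurable (hU.prodMk hV).aemeasurable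
  rw [h.map_prod_eq_prod_map_map hU.aemeasurable hV.aemeasurable,
    ← Measure.prodAssoc_prod, ← h3] at h4
  -- Up to reassociation both sides are the product of the laws of `X`, `U` and `V`.
  apply (MeasurableEquiv.prodAssoc (α := α) (β := γ) (γ := δ)).map_measurableEquiv_injective
  rw [Measure.map_map MeasurableEquiv.prodAssoc.measurable ((hX.prodMk hU).prodMk hV)]
  exact h4

namespace SHS

variable {Q : Type*}

theorem measurable_jumpChain [Fintype Q] [MeasurableSpace Q] [MeasurableSingletonClass Q]
    (H : SHS Q) (n : ℕ) :
    Measurable fun z : (Q × ℝ) × (ℕ → Q → ℝ) => H.jumpChain z.2 z.1.1 z.1.2 n := by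
  induction n with
  | zero => exact measurable_const.prodMk (measurable_fst.fst.prodMk measurable_fst.snd)
  | succ n ih =>
    exact H.measurable_jumpStep.comp (ih.prodMk ((measurable_pi_apply n).comp measurable_snd))

theorem jumpChain_congr [Fintype Q] (H : SHS Q) {s s' : ℕ → Q → ℝ} (q : Q) (x : ℝ) {n : ℕ}
    (h : ∀ k < n, s k = s' k) : H.jumpChain s q x n = H.jumpChain s' q x n := by
  induction n with
  | zero => rfl
  | succ n ih =>
    simp only [jumpChain, ih fun k hk => h k (hk.trans n.lt_succ_self), h n n.lt_succ_self]

theorem jumpChain_nonneg [Fintype Q] (H : SHS Q) (s : ℕ → Q → ℝ) (q : Q) {x : ℝ}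
    (hx : 0 ≤ x) (n : ℕ) : 0 ≤ (H.jumpChain s q x n).2.2 := by
  induction n with
  | zero => exact hx
  | succ n ih => exact mul_nonneg (H.γ_nonneg _ _) (H.flow_waitTime_nonneg ih (s n))

section Input

variable {H : SHS Q} [MeasurableSpace Q] {Ω : Type*} [MeasurableSpace Ω] {P : Measure Ω}
  {S : ℕ → Q → Ω → ℝ} {Q₀ : Ω → Q} {X₀ : Ω → ℝ}

theorem IsInput.measurable_init (hI : IsInput P S Q₀ X₀) :
    Measurable fun ω => ((Q₀ ω, X₀ ω), fun n q => S n q ω) := by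
  refine (hI.measurable_discrete.prodMk hI.measurable_cont).prodMk ?_
  exact measurable_pi_lambda _ fun n => measurable_pi_lambda _ fun q => hI.measurable_clock n q

/-- The first `n` jumps use only the initial state and the clocks with index below `n`, which are
jointly independent of the clocks with index `n`. -/
theorem IsInput.indepFun_jumpChain [Fintype Q] [MeasurableSingletonClass Q]
    [IsProbabilityMeasure P] (hI : IsInput P S Q₀ X₀) (n : ℕ) :
    IndepFun (fun ω => H.jumpChain (fun n q => S n q ω) (Q₀ ω) (X₀ ω) n)
      (fun ω q => S n q ω) P := by
  classical
  set A : Finset (ℕ × Q) := Finset.range n ×ˢ Finset.univ with hA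
  set B : Finset (ℕ × Q) := {n} ×ˢ Finset.univ with hB
  have hAB : Disjoint A B := by
    rw [Finset.disjoint_left]
    rintro ⟨k, q⟩ h1 h2
    simp only [hA, hB, Finset.mem_product, Finset.mem_range, Finset.mem_singleton] at h1 h2
    omega
  have hmA : ∀ k, k < n → ∀ q, (k, q) ∈ A := fun k hk q => by simp [hA, hk]
  have hmB : ∀ q, (n, q) ∈ B := fun q => by simp [hB]
  have hind := hI.clock_indep.indepFun_finset A B hAB fun i => hI.measurable_clock i.1 i.2
  have hW : Measurable fun ω (i : ℕ × Q) => S i.1 i.2 ω :=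
    measurable_pi_lambda _ fun i => hI.measurable_clock i.1 i.2
  have h1 := hI.indep_init.prodMk_of_indepFun
    (hI.measurable_discrete.prodMk hI.measurable_cont) hW
    (φ := fun w (i : A) => w i) (ψ := fun w (i : B) => w i)
    (measurable_pi_lambda _ fun i => measurable_pi_apply _)
    (measurable_pi_lambda _ fun i => measurable_pi_apply _) hind
  -- The clocks not yet used are filled with `0`; by `jumpChain_congr` this does not change the
  -- chain up to jump `n`.
  set ext : (A → ℝ) → ℕ → Q → ℝ := fun w k q =>
    if h : k < n then w ⟨(k, q), hmA k h q⟩ else 0 with hext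
  have hextm : Measurable ext := by
    refine measurable_pi_lambda _ fun k => measurable_pi_lambda _ fun q => ?_
    by_cases h : k < n
    · simp only [hext, dif_pos h]
      exact measurable_pi_apply _
    · simp only [hext, dif_neg h]
      exact measurable_const
  have h2 := h1.comp (φ := fun z : (Q × ℝ) × (A → ℝ) => H.jumpChain (ext z.2) z.1.1 z.1.2 n)
    (ψ := fun (w : B → ℝ) q => w ⟨(n, q), hmB q⟩)
    ((H.measurable_jumpChain n).comp (measurable_fst.prodMk (hextm.comp measurable_snd)))
    (measurable_pi_lambda _ fun q => measurable_pi_apply _)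
  convert h2 using 1
  · funext ω
    refine H.jumpChain_congr _ _ fun k hk => ?_
    funext q
    simp [hext, hk]
  · rfl

theorem IsInput.map_clocks [Fintype Q] (hI : IsInput P S Q₀ X₀) (n : ℕ) :
    P.map (fun ω q => S n q ω) = Measure.pi fun _ : Q => expMeasure 1 := by
  have h1 : iIndepFun (fun q => S n q) P :=
    hI.clock_indep.precomp (g := fun q : Q => (n, q)) fun _ _ h => (Prod.mk.inj h).2
  rw [h1.map_fun_eq_pi_map fun q => (hI.measurable_clock n q).aemeasurable]
  simp only [hI.clock_law]

/-- The clocks for the next jump may be integrated out, given the state after the last one. -/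
theorem IsInput.lintegral_jumpChain [Fintype Q] [MeasurableSingletonClass Q]
    [IsProbabilityMeasure P] (hI : IsInput P S Q₀ X₀) (n : ℕ)
    {h : (ℝ≥0∞ × Q × ℝ) × (Q → ℝ) → ℝ≥0∞} (hh : Measurable h) :
    ∫⁻ ω, h (H.jumpChain (fun n q => S n q ω) (Q₀ ω) (X₀ ω) n, fun q => S n q ω) ∂P
      = ∫⁻ ω, ∫⁻ s, h (H.jumpChain (fun n q => S n q ω) (Q₀ ω) (X₀ ω) n, s)
          ∂Measure.pi (fun _ : Q => expMeasure 1) ∂P := by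
  have hZ : Measurable fun ω => H.jumpChain (fun n q => S n q ω) (Q₀ ω) (X₀ ω) n :=
    (H.measurable_jumpChain n).comp hI.measurable_init
  have hS : Measurable fun ω q => S n q ω :=
    measurable_pi_lambda _ fun q => hI.measurable_clock n q
  rw [← lintegral_map (f := h) hh (hZ.prodMk hS),
    (hI.indepFun_jumpChain (H := H) n).map_prod_eq_prod_map_map hZ.aemeasurable hS.aemeasurable,
    hI.map_clocks n, lintegral_prod _ hh.aemeasurable,
    lintegral_map hh.lintegral_prod_right' hZ]

end Input

end SHS

/-! ### Summation over the jumps -/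

namespace SHS

variable {Q : Type*} [Fintype Q]

open Classical in
/-- The contribution to `E[v Q_t * X_t ^ m]` of the event that exactly the jumps that have led to
`z` have taken place at time `t`. -/
noncomputable def activeTerm (H : SHS Q) (v : Q → ℝ) (m : ℕ) (t : ℝ≥0)
    (z : (ℝ≥0∞ × Q × ℝ) × (Q → ℝ)) : ℝ≥0∞ :=
  if z.1.1 ≤ t ∧ t < z.1.1 + H.waitTime z.1.2.1 z.1.2.2 z.2 then
    if Survives (H.f z.1.2.1) z.1.2.2 (t - z.1.1.toNNReal : ℝ≥0) then
      ENNReal.ofReal (v z.1.2.1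
        * flow (H.f z.1.2.1) z.1.2.2 (t - z.1.1.toNNReal : ℝ≥0) ^ m)
    else ⊤
  else 0

/-- The bound for the contribution to `E[v Q_t * X_t ^ m]` of the future of `z`. -/
noncomputable def futureTerm (v : Q → ℝ) (ε K : ℝ) (m : ℕ) (t : ℝ≥0) (z : ℝ≥0∞ × Q × ℝ) :
    ℝ≥0∞ :=
  if z.1 ≤ t then ENNReal.ofReal (lyapBound v ε K m (t - z.1.toReal) z.2.1 z.2.2) else 0

variable {v : Q → ℝ} {ε K : ℝ} {m : ℕ}

theorem measurable_activeTerm [MeasurableSpace Q] [MeasurableSingletonClass Q] (H : SHS Q)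
    (t : ℝ≥0) : Measurable (H.activeTerm v m t) := by
  have hw : Measurable fun y : Q × ℝ × (Q → ℝ) => H.waitTime y.1 y.2.1 y.2.2 :=
    measurable_from_prod_countable_right fun q => H.measurable_waitTime q
  have hf : Measurable fun y : Q × ℝ × ℝ≥0 => flow (H.f y.1) y.2.1 y.2.2 :=
    measurable_from_prod_countable_right fun q => measurable_flow (H.f q)
  have hs : Measurable fun y : Q × ℝ × ℝ≥0 => Survives (H.f y.1) y.2.1 y.2.2 :=
    measurable_from_prod_countable_right fun q => (measurableSet_survives (H.f q)).mem
  have hv : Measurable v := measurable_of_finite _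
  have hw' := hw.comp (by fun_prop :
    Measurable fun z : (ℝ≥0∞ × Q × ℝ) × (Q → ℝ) => (z.1.2.1, z.1.2.2, z.2))
  have hi : Measurable fun z : (ℝ≥0∞ × Q × ℝ) × (Q → ℝ) =>
      (z.1.2.1, z.1.2.2, t - z.1.1.toNNReal) :=
    measurable_fst.snd.fst.prodMk (measurable_fst.snd.snd.prodMk
      (measurable_const.sub (ENNReal.measurable_toNNReal.comp measurable_fst.fst)))
  refine Measurable.ite ?_ (Measurable.ite ?_ ?_ measurable_const) measurable_const
  · exact (measurableSet_le measurable_fst.fst measurable_const).inter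
      (measurableSet_lt measurable_const (measurable_fst.fst.add hw'))
  · exact measurableSet_setOfPred.2 (hs.comp hi)
  · exact ((hv.comp measurable_fst.snd.fst).mul ((hf.comp hi).pow_const m)).ennreal_ofReal

theorem measurable_futureTerm [MeasurableSpace Q] [MeasurableSingletonClass Q] (t : ℝ≥0) :
    Measurable (futureTerm v ε K m t) := by
  have hl : Measurable fun y : Q × ℝ × ℝ => lyapBound v ε K m y.2.1 y.1 y.2.2 :=
    measurable_from_prod_countable_right fun q => (continuous_lyapBound q).measurable
  refine Measurable.ite (measurableSet_le measurable_fst measurable_const) ?_ measurable_const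
  exact (hl.comp (measurable_snd.fst.prodMk ((measurable_const.sub
    (ENNReal.measurable_toReal.comp measurable_fst)).prodMk measurable_snd.snd))).ennreal_ofReal

/-- The state of the jump chain after the next jump. -/
noncomputable def jumpStep (H : SHS Q) (z : (ℝ≥0∞ × Q × ℝ) × (Q → ℝ)) : ℝ≥0∞ × Q × ℝ :=
  (z.1.1 + H.waitTime z.1.2.1 z.1.2.2 z.2, H.target z.1.2.1 z.1.2.2 z.2,
    H.γ z.1.2.1 (H.target z.1.2.1 z.1.2.2 z.2) *
      flow (H.f z.1.2.1) z.1.2.2 (H.waitTime z.1.2.1 z.1.2.2 z.2).toReal)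

/-- The one-step inequality for the jump chain. -/
theorem lintegral_jumpStep_le [MeasurableSpace Q] [MeasurableSingletonClass Q] {H : SHS Q}
    (hm : 1 ≤ m) (hv : ∀ q, 0 < v q) (hε : 0 ≤ ε) (hK : 0 ≤ K)
    (hdrift : ∀ q x, 0 ≤ x → (H.genPoly v m q).eval x
      ≤ K * ε - ε * (v q * x ^ m) - ∑ l, (H.rate q l).eval x)
    (t : ℝ≥0) (z : ℝ≥0∞ × Q × ℝ) (hz : 0 ≤ z.2.2) :
    ∫⁻ s, (H.activeTerm v m t (z, s)
        + (if (H.jumpStep (z, s)).1 ≤ t then ENNReal.ofReal (Real.exp (-(ε * t))) else 0)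
        + futureTerm v ε K m t (H.jumpStep (z, s))) ∂Measure.pi (fun _ : Q => expMeasure 1)
      ≤ futureTerm v ε K m t z := by
  classical
  obtain ⟨T, q, x⟩ := z
  by_cases hT : T ≤ t
  · lift T to ℝ≥0 using ne_top_of_le_ne_top ENNReal.coe_ne_top hT
    have hT' : T ≤ t := ENNReal.coe_le_coe.1 hT
    have hsub : ((t - T : ℝ≥0) : ℝ) = t - T := NNReal.coe_sub hT'
    -- The one-step inequality is applied afresh at time `T` with the remaining time `t - T`. Its
    -- reward `exp (-ε (t - T))` is at least `exp (-ε t)`, so the same reward serves for every jump.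
    have key := lintegral_step_le hm hv hε hK hdrift (q := q) (t := t - T) hz
    refine (lintegral_mono fun s => ?_).trans (key.trans_eq ?_)
    · have hiff : (T : ℝ≥0∞) + H.waitTime q x s ≤ t ↔ H.waitTime q x s ≤ (t - T : ℝ≥0) := by
        rw [ENNReal.coe_sub, ENNReal.le_sub_iff_add_le_left ENNReal.coe_ne_top hT]
      simp only [activeTerm, futureTerm, jumpStep, hT, true_and, ENNReal.toNNReal_coe,
        ← not_le, hiff]
      by_cases hw : H.waitTime q x s ≤ (t - T : ℝ≥0)
      · have hwtop := ne_top_of_le_ne_top ENNReal.coe_ne_top hw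
        have hwle : (H.waitTime q x s).toReal ≤ (t - T : ℝ≥0) :=
          ENNReal.toReal_mono ENNReal.coe_ne_top hw
        simp only [hw, not_true, if_true, if_false, zero_add,
          ENNReal.toReal_add ENNReal.coe_ne_top hwtop, ENNReal.coe_toReal]
        rw [← ENNReal.ofReal_add (Real.exp_pos _).le]
        · refine ENNReal.ofReal_le_ofReal (add_le_add ?_ ?_)
          · rw [Real.exp_le_exp, hsub]
            have := mul_nonneg hε T.coe_nonneg
            linarith
          · rw [hsub, sub_sub]
        · rw [← sub_sub, ← hsub]
          exact lyapBound_nonneg (fun q => (hv q).le) hε hK (by linarith) _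
            (mul_nonneg (H.γ_nonneg _ _) (H.flow_waitTime_nonneg hz s))
      · simp only [hw, not_false_eq_true, if_true, if_false, add_zero]
        exact le_rfl
    · simp only [futureTerm, hT, if_true, hsub, ENNReal.coe_toReal]
  -- If `T > t` the next jump is also later than `t`, and both sides vanish.
  · have h1 : ∀ s, ¬(H.jumpStep ((T, q, x), s)).1 ≤ t := fun s h => hT (le_self_add.trans h)
    simp only [futureTerm, activeTerm, h1, hT, false_and, if_false, add_zero, lintegral_zero,
      le_refl]

end SHS

namespace SHS

variable {Q : Type*} [Fintype Q]

open Classical in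
/-- Unless the jump times accumulate before time `t`, the `m`-th power of the continuous state is
controlled by the active terms. -/
theorem contState_pow_le (H : SHS Q) {v : Q → ℝ} (hv : ∀ q, 0 < v q) {m : ℕ}
    (s : ℕ → Q → ℝ) (q : Q) {x : ℝ} (hx : 0 ≤ x) {t : ℝ≥0}
    (hex : ∃ n, (t : ℝ≥0∞) < (H.jumpChain s q x n).1) :
    H.contState s q x t ^ m ≤ ENNReal.ofReal (∑ q, (v q)⁻¹)
      * ∑' n, H.activeTerm v m t (H.jumpChain s q x n, s n) := by
  have hsub : ∀ n, (H.jumpChain s q x n).1 ≤ t →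
      ((t - (H.jumpChain s q x n).1.toNNReal : ℝ≥0) : ℝ) = t - (H.jumpChain s q x n).1.toReal :=
    fun n hn => NNReal.coe_sub (by simpa using ENNReal.toNNReal_mono ENNReal.coe_ne_top hn)
  by_cases hact : ∃ n, H.IsActive s q x t n
  · set n := hact.choose with hn
    have h1 : H.IsActive s q x t n := hact.choose_spec
    have hstate : H.contState s q x t = ENNReal.ofReal (flow (H.f (H.jumpChain s q x n).2.1)
        (H.jumpChain s q x n).2.2 (t - (H.jumpChain s q x n).1.toReal)) := by
      simp only [contState, state, dif_pos hact, ← hn]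
    have hterm : H.activeTerm v m t (H.jumpChain s q x n, s n)
        = ENNReal.ofReal (v (H.jumpChain s q x n).2.1 * flow (H.f (H.jumpChain s q x n).2.1)
        (H.jumpChain s q x n).2.2 (t - (H.jumpChain s q x n).1.toReal) ^ m) := by
      have h2 : (t : ℝ≥0∞) < (H.jumpChain s q x n).1
          + H.waitTime (H.jumpChain s q x n).2.1 (H.jumpChain s q x n).2.2 (s n) := h1.2.1
      simp only [activeTerm, h1.1, h2, true_and, if_true, hsub n h1.1, h1.2.2]
    have h0 : 0 ≤ flow (H.f (H.jumpChain s q x n).2.1) (H.jumpChain s q x n).2.2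
        (t - (H.jumpChain s q x n).1.toReal) :=
      h1.2.2.flow_nonneg (H.f_zero_nonneg _) (H.jumpChain_nonneg s q hx n) _
        ⟨hsub n h1.1 ▸ NNReal.coe_nonneg _, le_rfl⟩
    refine le_trans ?_ (mul_le_mul_right (ENNReal.le_tsum n) _)
    have h4 : ∀ r, (v r)⁻¹ ≤ ∑ q, (v q)⁻¹ := fun r => Finset.single_le_sum
      (f := fun q => (v q)⁻¹) (fun q _ => (inv_pos.2 (hv q)).le) (Finset.mem_univ r)
    rw [hstate, hterm, ← ENNReal.ofReal_pow h0,
      ← ENNReal.ofReal_mul (Finset.sum_nonneg fun q _ => (inv_pos.2 (hv q)).le)]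
    refine ENNReal.ofReal_le_ofReal ?_
    rw [← mul_assoc]
    refine le_mul_of_one_le_left (pow_nonneg h0 m) ?_
    rw [← inv_mul_cancel₀ (hv (H.jumpChain s q x n).2.1).ne']
    exact mul_le_mul_of_nonneg_right (h4 _) (hv _).le
  -- With no active index, the trajectory that follows the last jump before `t` has blown up by time
  -- `t`, so its term is `⊤`.
  · have hpos : 0 < Nat.find hex := by
      rw [Nat.find_pos]
      simp [jumpChain]
    obtain ⟨n, hn⟩ := Nat.exists_eq_succ_of_ne_zero hpos.ne'
    have h1 : (t : ℝ≥0∞) < (H.jumpChain s q x (n + 1)).1 := by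
      have := Nat.find_spec hex
      rwa [hn] at this
    have h2 : (H.jumpChain s q x n).1 ≤ t := by
      have := Nat.find_min hex (m := n) (by omega)
      exact not_lt.1 this
    have h3 : ¬Survives (H.f (H.jumpChain s q x n).2.1) (H.jumpChain s q x n).2.2
        (t - (H.jumpChain s q x n).1.toReal) := fun h => hact ⟨n, h2, h1, h⟩
    have hterm : H.activeTerm v m t (H.jumpChain s q x n, s n) = ⊤ := by
      have h4 : (t : ℝ≥0∞) < (H.jumpChain s q x n).1
          + H.waitTime (H.jumpChain s q x n).2.1 (H.jumpChain s q x n).2.2 (s n) := h1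
      simp only [activeTerm, h2, h4, true_and, if_true, hsub n h2, h3, if_false]
    have htop : ∑' n, H.activeTerm v m t (H.jumpChain s q x n, s n) = ⊤ :=
      top_le_iff.1 (hterm ▸ ENNReal.le_tsum n)
    rw [htop, ENNReal.mul_top]
    · exact le_top
    · rw [ne_eq, ENNReal.ofReal_eq_zero, not_le]
      exact Finset.sum_pos (fun q _ => inv_pos.2 (hv q)) ⟨q, Finset.mem_univ q⟩

/-- Under a drift condition the `m`-th moment of the process is bounded. -/
theorem exists_processMoment_le [MeasurableSpace Q] [MeasurableSingletonClass Q] {H : SHS Q}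
    {v : Q → ℝ} {ε K : ℝ} {m : ℕ} (hm : 1 ≤ m) (hv : ∀ q, 0 < v q) (hε : 0 ≤ ε) (hK : 0 ≤ K)
    (hdrift : ∀ q x, 0 ≤ x → (H.genPoly v m q).eval x
      ≤ K * ε - ε * (v q * x ^ m) - ∑ l, (H.rate q l).eval x)
    {Ω : Type*} [MeasurableSpace Ω] {P : Measure Ω} [IsProbabilityMeasure P]
    {S : ℕ → Q → Ω → ℝ} {Q₀ : Ω → Q} {X₀ : Ω → ℝ} (hI : IsInput P S Q₀ X₀)
    (hX₀ : ∫⁻ ω, ENNReal.ofReal (X₀ ω) ^ m ∂P < ∞) :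
    ∃ C : ℝ≥0, ∀ t : ℝ≥0, H.processMoment P S Q₀ X₀ m t ≤ C := by
  set M : ℝ≥0∞ := ENNReal.ofReal (∑ q, v q) * (∫⁻ ω, ENNReal.ofReal (X₀ ω) ^ m ∂P)
    + ENNReal.ofReal K with hM
  have hMtop : M ≠ ⊤ :=
    ENNReal.add_ne_top.2 ⟨ENNReal.mul_ne_top ENNReal.ofReal_ne_top hX₀.ne, ENNReal.ofReal_ne_top⟩
  set R : ℝ≥0∞ := ENNReal.ofReal (∑ q, (v q)⁻¹) * M with hR
  have hRtop : R ≠ ⊤ := ENNReal.mul_ne_top ENNReal.ofReal_ne_top hMtop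
  refine ⟨R.toNNReal, fun t => ?_⟩
  rw [ENNReal.coe_toNNReal hRtop]
  set Z : ℕ → Ω → ℝ≥0∞ × Q × ℝ :=
    fun n ω => H.jumpChain (fun n q => S n q ω) (Q₀ ω) (X₀ ω) n with hZ
  have hZm : ∀ n, Measurable (Z n) := fun n => (H.measurable_jumpChain n).comp hI.measurable_init
  have hSm : ∀ n, Measurable fun ω q => S n q ω := fun n =>
    measurable_pi_lambda _ fun q => hI.measurable_clock n q
  set c : ℝ≥0∞ := ENNReal.ofReal (Real.exp (-(ε * t))) with hc
  set a : ℕ → Ω → ℝ≥0∞ := fun n ω => H.activeTerm v m t (Z n ω, fun q => S n q ω) with ha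
  -- The reward, independent of `n` and positive, for each jump that happens up to time `t`.
  set b : ℕ → Ω → ℝ≥0∞ := fun n ω => if (Z (n + 1) ω).1 ≤ t then c else 0 with hb
  set D : ℕ → Ω → ℝ≥0∞ := fun n ω => futureTerm v ε K m t (Z n ω) with hD
  have ham : ∀ n, Measurable (a n) := fun n =>
    (H.measurable_activeTerm t).comp ((hZm n).prodMk (hSm n))
  have hbm : ∀ n, Measurable (b n) := fun n => Measurable.ite
    (measurableSet_le (hZm (n + 1)).fst measurable_const) measurable_const measurable_const
  have hstepm : Measurable H.jumpStep := H.measurable_jumpStep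
  have hstep : ∀ n, ∫⁻ ω, a n ω ∂P + ∫⁻ ω, b n ω ∂P + ∫⁻ ω, D (n + 1) ω ∂P ≤ ∫⁻ ω, D n ω ∂P := by
    intro n
    rw [← lintegral_add_left (ham n),
      ← lintegral_add_left (f := fun ω => a n ω + b n ω) ((ham n).add (hbm n))]
    have h1 := hI.lintegral_jumpChain (H := H) n (h := fun z => H.activeTerm v m t z
        + (if (H.jumpStep z).1 ≤ t then c else 0) + futureTerm v ε K m t (H.jumpStep z))
      (((H.measurable_activeTerm t).add (Measurable.ite
        (measurableSet_le hstepm.fst measurable_const) measurable_const measurable_const)).add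
        ((measurable_futureTerm t).comp hstepm))
    refine (le_of_eq h1).trans (lintegral_mono_ae ?_)
    filter_upwards [hI.cont_nonneg] with ω hω
    exact lintegral_jumpStep_le hm hv hε hK hdrift t (Z n ω) (H.jumpChain_nonneg _ _ hω n)
  -- The one-step inequalities telescope, with no integrability needed.
  have hsum : ∀ N, ∑ n ∈ Finset.range N, (∫⁻ ω, a n ω ∂P + ∫⁻ ω, b n ω ∂P) + ∫⁻ ω, D N ω ∂P
      ≤ ∫⁻ ω, D 0 ω ∂P := by
    intro N
    induction N with
    | zero => simp
    | succ N ih =>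
      rw [Finset.sum_range_succ, add_assoc]
      exact (add_le_add le_rfl (hstep N)).trans ih
  have hD0 : ∫⁻ ω, D 0 ω ∂P ≤ M := by
    rw [hM, ← lintegral_const_mul _ (hI.measurable_cont.ennreal_ofReal.pow_const m)]
    have h1 : ∫⁻ _ : Ω, ENNReal.ofReal K ∂P = ENNReal.ofReal K := by simp
    rw [← h1, ← lintegral_add_right _ measurable_const]
    refine lintegral_mono_ae ?_
    filter_upwards [hI.cont_nonneg] with ω hω
    have hvs : 0 ≤ ∑ q, v q := Finset.sum_nonneg fun q _ => (hv q).le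
    simp only [hD, hZ, futureTerm, jumpChain, zero_le, if_true, ENNReal.toReal_zero, sub_zero]
    rw [← ENNReal.ofReal_pow hω, ← ENNReal.ofReal_mul hvs,
      ← ENNReal.ofReal_add (mul_nonneg hvs (pow_nonneg hω m)) hK]
    refine ENNReal.ofReal_le_ofReal ((lyapBound_le (fun q => (hv q).le) hε hK t.coe_nonneg _
      hω).trans ?_)
    have h2 : v (Q₀ ω) ≤ ∑ q, v q := Finset.single_le_sum (f := v) (fun q _ => (hv q).le)
      (Finset.mem_univ (Q₀ ω))
    have h3 := mul_le_mul_of_nonneg_right h2 (pow_nonneg hω m)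
    linarith
  have htsum : ∑' n, (∫⁻ ω, a n ω ∂P + ∫⁻ ω, b n ω ∂P) ≤ M :=
    ENNReal.tsum_le_of_sum_range_le fun N => (le_self_add.trans (hsum N)).trans hD0
  have hasum : ∫⁻ ω, ∑' n, a n ω ∂P ≤ M := by
    rw [lintegral_tsum fun n => (ham n).aemeasurable]
    exact (ENNReal.tsum_le_tsum fun n => le_self_add).trans htsum
  have hbsum : ∫⁻ ω, ∑' n, b n ω ∂P ≤ M := by
    rw [lintegral_tsum fun n => (hbm n).aemeasurable]
    exact (ENNReal.tsum_le_tsum fun n => le_add_self).trans htsum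
  -- A finite sum of equal positive rewards means finitely many jumps up to `t`, so the jump times
  -- do not accumulate.
  have hfin : ∀ᵐ ω ∂P, ∑' n, b n ω < ⊤ :=
    ae_lt_top (Measurable.tsum hbm) (ne_top_of_le_ne_top hMtop hbsum)
  have hpt : ∀ᵐ ω ∂P, H.contState (fun n q => S n q ω) (Q₀ ω) (X₀ ω) t ^ m
      ≤ ENNReal.ofReal (∑ q, (v q)⁻¹) * ∑' n, a n ω := by
    filter_upwards [hfin, hI.cont_nonneg] with ω hω hω0
    refine H.contState_pow_le hv _ _ hω0 ?_
    by_contra! hcon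
    have h1 : ∀ n, b n ω = c := fun n => if_pos (hcon (n + 1))
    simp only [h1] at hω
    refine hω.ne (ENNReal.tsum_const_eq_top_of_ne_zero ?_)
    rw [hc, ne_eq, ENNReal.ofReal_eq_zero, not_le]
    exact Real.exp_pos _
  calc H.processMoment P S Q₀ X₀ m t
      ≤ ∫⁻ ω, ENNReal.ofReal (∑ q, (v q)⁻¹) * ∑' n, a n ω ∂P := lintegral_mono_ae hpt
    _ = ENNReal.ofReal (∑ q, (v q)⁻¹) * ∫⁻ ω, ∑' n, a n ω ∂P :=
        lintegral_const_mul _ (Measurable.tsum ham)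
    _ ≤ R := mul_le_mul_right hasum _

end SHS

theorem mainTheorem4 {Q : Type*} [Fintype Q] [DecidableEq Q]
    [MeasurableSpace Q] [MeasurableSingletonClass Q]
    (H : SHS Q) (hdeg : H.degF ≤ H.degRate) :
    (∀ m : ℕ, 1 ≤ m → SHS.NegativeSpectrum (H.topMatrix m) →
      (∀ ρ : ℝ → Measure (Q × ℝ), H.IsMomentOrbit ρ →
        ∃ C : ℝ, ∀ t, 0 ≤ t → |SHS.totalMoment (ρ t) m| ≤ C) ∧
      (∀ (Ω : Type*) [MeasurableSpace Ω] (P : Measure Ω) [IsProbabilityMeasure P]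
        (S : ℕ → Q → Ω → ℝ) (Q₀ : Ω → Q) (X₀ : Ω → ℝ), SHS.IsInput P S Q₀ X₀ →
        ∫⁻ ω, ENNReal.ofReal (X₀ ω) ^ m ∂P < ∞ →
        ∃ C : ℝ≥0, ∀ t : ℝ≥0, H.processMoment P S Q₀ X₀ m t ≤ C)) ∧
    ((∀ m : ℕ, 1 ≤ m → SHS.NegativeSpectrum (H.topMatrix m)) →
      (∀ ρ : ℝ → Measure (Q × ℝ), H.IsMomentOrbit ρ →
        ∀ m : ℕ, 1 ≤ m → ∃ C : ℝ, ∀ t, 0 ≤ t → |SHS.totalMoment (ρ t) m| ≤ C) ∧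
      (∀ (Ω : Type*) [MeasurableSpace Ω] (P : Measure Ω) [IsProbabilityMeasure P]
        (S : ℕ → Q → Ω → ℝ) (Q₀ : Ω → Q) (X₀ : Ω → ℝ), SHS.IsInput P S Q₀ X₀ →
        (∀ m : ℕ, 1 ≤ m → ∫⁻ ω, ENNReal.ofReal (X₀ ω) ^ m ∂P < ∞) →
        ∀ m : ℕ, 1 ≤ m → ∃ C : ℝ≥0, ∀ t : ℝ≥0, H.processMoment P S Q₀ X₀ m t ≤ C)) := by
  have orbit : ∀ m : ℕ, 1 ≤ m → SHS.NegativeSpectrum (H.topMatrix m) →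
      ∀ ρ : ℝ → Measure (Q × ℝ), H.IsMomentOrbit ρ →
        ∃ C : ℝ, ∀ t, 0 ≤ t → |SHS.totalMoment (ρ t) m| ≤ C := by
    intro m hm hM ρ hρ
    obtain ⟨v, ε, K, hv, hε, hK, hdrift⟩ := SHS.exists_drift hdeg hm hM
    -- The spare rate term serves against explosion of the process only, and is dropped here.
    refine hρ.exists_totalMoment_le hm hv hε hK fun q x hx => (hdrift q x hx).trans ?_
    have := Finset.sum_nonneg fun l (_ : l ∈ Finset.univ) => H.rate_nonneg q l x hx
    linarith
  refine ⟨fun m hm hM => ⟨orbit m hm hM, ?_⟩, fun hM =>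
    ⟨fun ρ hρ m hm => orbit m hm (hM m hm) ρ hρ, ?_⟩⟩
  · intro Ω _ P _ S Q₀ X₀ hI hX₀
    obtain ⟨v, ε, K, hv, hε, hK, hdrift⟩ := SHS.exists_drift hdeg hm hM
    exact SHS.exists_processMoment_le hm hv hε.le hK hdrift hI hX₀
  · intro Ω _ P _ S Q₀ X₀ hI hX₀ m hm
    obtain ⟨v, ε, K, hv, hε, hK, hdrift⟩ := SHS.exists_drift hdeg hm (hM m hm)
    exact SHS.exists_processMoment_le hm hv hε.le hK hdrift hI (hX₀ m hm)
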